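/- Let $k\ge 2$. A finite hypergraph $\mathcal G=(V,E)$ consists of a finite vertex set $V$ and a set $E$ of non-empty subsets of $V$ (edges); it is $k$-uniform if every edge has exactly $k$ vertices. Two distinct vertices $u,v$ are adjacent, $u\sim v$, if some edge contains both. A path of length $p$ is a sequence $(u_1,e_1,u_2,\dots,e_p,u_{p+1})$ of distinct vertices and distinct edges with $u_i,u_{i+1}\in e_i$; a cycle is such a sequence with $p\ge 2$, distinct edges, $u_1,\dots,u_p$ distinct and $u_{p+1}=u_1$. A supertree is a (non-empty) connected hypergraph without cycles, and $\mathrm{dist}(u,v)$ is the length of a shortest path from $u$ to $v$. The degree $d(v)$ is the number of edges containing $v$; the degree sequence is the multiset of all degrees. The boundary $\partial V$ is the set of vertices of degree one, and $V^\circ=V\setminus\partial V$ is the set of interior vertices. For a multiset $\pi$ of natural numbers let $\mathcal T_\pi$ be the class of $k$-uniform supertrees with degree sequence $\pi$. The Laplacian of $\mathcal G$ is $L_{\mathcal G}=D-A$ with $D=\mathrm{diag}(d(v))$, $a_{ij}=\sum_{e\in E,\ \{i,j\}\subseteq e}\frac1{|e|-1}$ for $i\ne j$ and $a_{ii}=0$.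 A real $\lambda$ is a Dirichlet eigenvalue of $\mathcal G$ if there is a function $f\neq 0$ on $V$ with $L_{\mathcal G}f(u)=\lambda f(u)$ for all $u\in V^\circ$ and $f(u)=0$ for all $u\in\partial V$. Let $\lambda(\mathcal G)$ be the smallest Dirichlet eigenvalue (with $\lambda(\mathcal G)=0$ by convention if $V^\circ=\emptyset$, which for a supertree happens only if it consists of a single edge). A supertree $\mathcal G\in\mathcal T_\pi$ has the Faber--Krahn property in $\mathcal T_\pi$ if $\lambda(\mathcal G)\le\lambda(\mathcal G')$ for all $\mathcal G'\in\mathcal T_\pi$. Given a root $v_0\in V$, put $h(v)=\mathrm{dist}(v,v_0)$; $u$ is the parent of $v$ if $u\sim v$ and $h(v)=h(u)+1$. A supertree has an SLO-ordering (spiral-like ordering) if for some root $v_0$ there is a well-ordering $\prec$ of $V$ such that: (S1) $u\prec v$ implies $h(u)\le h(v)$; (S2) if $u,v$ are the parents of $u_1,v_1$ respectively and $u\prec v$, then $u_1\prec v_1$; (S3) if $u\prec v$ and $u\in\partial V$, then $v\in\partial V$; (S4) if $e=\{u_1,\dots,u_k\}\in E$ with $u_1\prec\dots\prec u_k$, then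 there is no $v\in V\setminus e$ with $u_i\prec v\prec u_{i+1}$ for some $2\le i\le k-1$; (S5) for $u,v\in V^\circ$, $u\prec v$ implies $d(u)\le d(v)$. Theorem. A supertree $\mathcal G\in\mathcal T_\pi$ has the Faber--Krahn property in $\mathcal T_\pi$ if and only if it has an SLO-ordering. Moreover, if $\mathcal T_\pi$ is non-empty, then a supertree with the Faber--Krahn property in $\mathcal T_\pi$ exists and is unique up to isomorphism. -/

import Mathlib

universe u

/-- A finite hypergraph with vertex set `V` and no multiple edges: a set of non-empty subsets
of `V`, the edges. -/
@[ext]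
structure FinHypergraph (V : Type u) where
  /-- The set of edges. -/
  edges : Finset (Finset V)
  /-- Edges are non-empty. -/
  nonempty_of_mem : ∀ e ∈ edges, e.Nonempty

namespace FinHypergraph

/-- Every edge has exactly `k` vertices. -/
def IsUniform {V : Type u} (G : FinHypergraph V) (k : ℕ) : Prop :=
  ∀ e ∈ G.edges, e.card = k

/-- The graph joining two distinct vertices whenever they share an edge. A walk in this graph is
a vertex-edge alternating sequence in the hypergraph; a shortest one repeats neither a vertex nor
an edge, so connectedness and distance in this graph are those given by paths of the hypergraph. -/
def adjGraph {V : Type u} (G : FinHypergraph V) : SimpleGraph V where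
  Adj x y := x ≠ y ∧ ∃ e ∈ G.edges, x ∈ e ∧ y ∈ e
  symm := ⟨fun _ _ h => ⟨h.1.symm, h.2.imp fun _ he => ⟨he.1, he.2.2, he.2.1⟩⟩⟩
  loopless := ⟨fun _ h => h.1 rfl⟩

/-- `G` contains a cycle `(u₀, e₀, u₁, e₁, …, u_{p-1}, e_{p-1}, u₀)` with `p = m + 2 ≥ 2`,
distinct vertices `uᵢ`, distinct edges `eᵢ` and `uᵢ, uᵢ₊₁ ∈ eᵢ`. The index `i + 1` is taken
cyclically, in `Fin (m + 2)`. -/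
def HasCycle {V : Type u} (G : FinHypergraph V) : Prop :=
  ∃ (m : ℕ) (x : Fin (m + 2) → V) (e : Fin (m + 2) → Finset V),
    Function.Injective x ∧ Function.Injective e ∧
      ∀ i, e i ∈ G.edges ∧ x i ∈ e i ∧ x (i + 1) ∈ e i

/-- A supertree is a connected (in particular non-empty) acyclic hypergraph. -/
def IsSupertree {V : Type u} (G : FinHypergraph V) : Prop :=
  G.adjGraph.Connected ∧ ¬ G.HasCycle

/-- The number of edges that contain `v`. -/
def degree {V : Type u} [DecidableEq V] (G : FinHypergraph V) (v : V) : ℕ :=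
  (G.edges.filter fun e => v ∈ e).card

/-- The list of the degrees of all vertices, up to order. -/
def degreeSequence {V : Type u} [Fintype V] [DecidableEq V] (G : FinHypergraph V) : Multiset ℕ :=
  (Finset.univ : Finset V).val.map G.degree

/-- The boundary consists of the vertices of degree one; the other vertices are interior. -/
def IsBoundary {V : Type u} [DecidableEq V] (G : FinHypergraph V) (v : V) : Prop :=
  G.degree v = 1

/-- Membership in the class `T_π` of `k`-uniform supertrees with degree sequence `π`. -/
structure MemClass {V : Type u} [Fintype V] [DecidableEq V] (G : FinHypergraph V) (k : ℕ)
    (π : Multiset ℕ) : Prop where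
  isUniform : G.IsUniform k
  isSupertree : G.IsSupertree
  degreeSequence_eq : G.degreeSequence = π

/-- Banerjee's adjacency matrix: `a i j = ∑ 1 / (|e| - 1)` over the edges `e ⊇ {i, j}` for
`i ≠ j` (an empty sum if `i` and `j` are not adjacent), and `a i i = 0`. -/
noncomputable def adjMatrix {V : Type u} [DecidableEq V] (G : FinHypergraph V) : Matrix V V ℝ :=
  Matrix.of fun i j =>
    if i = j then 0
    else ∑ e ∈ G.edges.filter (fun e => i ∈ e ∧ j ∈ e), 1 / ((e.card : ℝ) - 1)

/-- The Laplacian matrix `L = D - A`. -/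
noncomputable def lapMatrix {V : Type u} [DecidableEq V] (G : FinHypergraph V) : Matrix V V ℝ :=
  Matrix.diagonal (fun v => (G.degree v : ℝ)) - G.adjMatrix

/-- `μ` is a Dirichlet eigenvalue: there is `f ≠ 0` with `L f = μ f` at all interior vertices and
`f = 0` at all boundary vertices. -/
def IsDirichletEigenvalue {V : Type u} [Fintype V] [DecidableEq V] (G : FinHypergraph V)
    (μ : ℝ) : Prop :=
  ∃ f : V → ℝ, f ≠ 0 ∧ (∀ v, ¬ G.IsBoundary v → G.lapMatrix.mulVec f v = μ * f v) ∧
    ∀ v, G.IsBoundary v → f v = 0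

/-- The first (smallest) Dirichlet eigenvalue. If there is at least one interior vertex, the set
is finite and non-empty; without interior vertices it is empty and the value is `0`. -/
noncomputable def firstDirichletEigenvalue {V : Type u} [Fintype V] [DecidableEq V]
    (G : FinHypergraph V) : ℝ :=
  sInf {μ : ℝ | G.IsDirichletEigenvalue μ}

/-- The Faber–Krahn property in `T_π`: `G` belongs to `T_π`, and its first Dirichlet eigenvalue is
minimal among those of all members of `T_π`. -/
def HasFaberKrahn {V : Type u} [Fintype V] [DecidableEq V] (G : FinHypergraph V) (k : ℕ)
    (π : Multiset ℕ) : Prop :=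
  G.MemClass k π ∧
    ∀ (W : Type u) [Fintype W] [DecidableEq W] (H : FinHypergraph W), H.MemClass k π →
      G.firstDirichletEigenvalue ≤ H.firstDirichletEigenvalue

/-- The height of `v` with respect to a root: its distance from the root. -/
noncomputable def height {V : Type u} (G : FinHypergraph V) (root v : V) : ℕ :=
  G.adjGraph.dist v root

/-- `p` is the parent of `c` (and `c` a child of `p`) with respect to a root. -/
def IsParent {V : Type u} (G : FinHypergraph V) (root p c : V) : Prop :=
  G.adjGraph.Adj p c ∧ G.height root c = G.height root p + 1

/-- The well-ordering `r` (written `≺` below) is a spiral-like ordering of `G` with root `root`. -/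
structure IsSLO {V : Type u} [DecidableEq V] (G : FinHypergraph V) (root : V)
    (r : V → V → Prop) : Prop where
  /-- `≺` is a (strict) well-ordering. -/
  isWellOrder : IsWellOrder V r
  /-- (S1) `u ≺ v` implies `h u ≤ h v`. -/
  s1 : ∀ u v, r u v → G.height root u ≤ G.height root v
  /-- (S2) If `u`, `v` are the parents of `u₁`, `v₁` and `u ≺ v`, then `u₁ ≺ v₁`. -/
  s2 : ∀ u v u₁ v₁, G.IsParent root u u₁ → G.IsParent root v v₁ → r u v → r u₁ v₁
  /-- (S3) If `u ≺ v` and `u` is a boundary vertex, then so is `v`. -/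
  s3 : ∀ u v, r u v → G.IsBoundary u → G.IsBoundary v
  /-- (S4) The vertices of an edge other than its `≺`-least one are consecutive: a vertex strictly
  between two vertices `x ≺ y` of `e`, where `x` is not the least vertex of `e`, lies in `e`. -/
  s4 : ∀ e ∈ G.edges, ∀ a ∈ e, ∀ x ∈ e, ∀ y ∈ e, r a x → ∀ v, r x v → r v y → v ∈ e
  /-- (S5) For interior vertices, `u ≺ v` implies `d u ≤ d v`. -/
  s5 : ∀ u v, ¬ G.IsBoundary u → ¬ G.IsBoundary v → r u v → G.degree u ≤ G.degree v

/-- `G` has an SLO-ordering, for some choice of the root. -/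
def HasSLO {V : Type u} [DecidableEq V] (G : FinHypergraph V) : Prop :=
  ∃ (root : V) (r : V → V → Prop), G.IsSLO root r

/-- `G` and `H` are isomorphic: a bijection of the vertices maps edges to edges, both ways. -/
def IsIsomorphic {V W : Type u} (G : FinHypergraph V) (H : FinHypergraph W) : Prop :=
  ∃ φ : V ≃ W, ∀ e : Finset V, e ∈ G.edges ↔ e.map φ.toEmbedding ∈ H.edges

end FinHypergraph

/-!
Only finitely many supertrees share a vertex set, so one of them minimizes the first Dirichlet
eigenvalue. Root it at a maximum of its ground state `f`. Exchanging vertices between edges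
preserves the class whenever the result is connected, and if it does not increase the Rayleigh
quotient of `f`, then by minimality `f` remains a ground state, which contradicts the eigenvalue
equation unless the exchange was trivial. Hence `f` decreases along the edges away from the root
and is compatible with parents, so that the vertices can be ordered by height, then by parents,
then by `f`; further exchanges show that the degrees increase along this order.

Conversely, a spiral-like ordering can be reconstructed from the degree sequence: it determines the
sequence of degrees in this order, the position of a vertex determines the number of edges before
it, and this number identifies the parent of the vertex. Two supertrees of the class with
spiral-like orderings are therefore isomorphic, which gives uniqueness and the converse.
-/

namespace FinHypergraph

/-! ### Linked vertices and cycles -/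

section Linked

variable {V : Type u} {G H : FinHypergraph V} {P Q : Finset V → Prop} {e : Finset V} {u v x y z : V}

theorem reachable_of_mem_edge (he : e ∈ G.edges) (hx : x ∈ e) (hy : y ∈ e) :
    G.adjGraph.Reachable x y := by
  by_cases h : x = y
  · exact h ▸ .refl _
  · exact SimpleGraph.Adj.reachable ⟨h, e, he, hx, hy⟩

theorem reachable_of_forall_edge (h : ∀ e ∈ G.edges, ∀ x ∈ e, ∀ y ∈ e, H.adjGraph.Reachable x y)
    (huv : G.adjGraph.Reachable u v) : H.adjGraph.Reachable u v := by
  obtain ⟨w⟩ := huv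
  induction w with
  | nil => exact .refl _
  | cons hadj _ ih =>
    obtain ⟨-, e, he, hx, hy⟩ := hadj
    exact (h e he _ hx _ hy).trans ih

open Classical in
/-- The partial hypergraph of `G` on the same vertices, formed by the edges that satisfy `P`. -/
noncomputable def restrict (G : FinHypergraph V) (P : Finset V → Prop) : FinHypergraph V where
  edges := G.edges.filter P
  nonempty_of_mem e he := G.nonempty_of_mem e (Finset.mem_filter.1 he).1

theorem mem_restrict_edges : e ∈ (G.restrict P).edges ↔ e ∈ G.edges ∧ P e := by
  simp [restrict]

/-- Two vertices are linked through `P` if a path joins them all of whose edges satisfy `P`. Paths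
that avoid certain edges are expressed in this way. -/
def Linked (G : FinHypergraph V) (P : Finset V → Prop) (x y : V) : Prop :=
  (G.restrict P).adjGraph.Reachable x y

theorem Linked.refl (x : V) : G.Linked P x x :=
  SimpleGraph.Reachable.refl x

theorem Linked.symm (h : G.Linked P x y) : G.Linked P y x :=
  SimpleGraph.Reachable.symm h

theorem Linked.trans (h : G.Linked P x y) (h' : G.Linked P y z) : G.Linked P x z :=
  SimpleGraph.Reachable.trans h h'

theorem linked_of_mem_edge (he : e ∈ G.edges) (hP : P e) (hx : x ∈ e) (hy : y ∈ e) :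
    G.Linked P x y :=
  reachable_of_mem_edge (mem_restrict_edges.2 ⟨he, hP⟩) hx hy

theorem Linked.reachable (h : ∀ e ∈ G.edges, P e → e ∈ H.edges) (hxy : G.Linked P x y) :
    H.adjGraph.Reachable x y :=
  reachable_of_forall_edge (fun e he _ hx _ hy =>
    have ⟨heG, heP⟩ := mem_restrict_edges.1 he
    reachable_of_mem_edge (h e heG heP) hx hy) hxy

theorem Linked.mono (h : ∀ e ∈ G.edges, P e → Q e) (hxy : G.Linked P x y) : G.Linked Q x y :=
  hxy.reachable fun e he hP => mem_restrict_edges.2 ⟨he, h e he hP⟩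

theorem exists_edges_of_length_eq_dist (w : G.adjGraph.Walk u v)
    (hw : w.length = G.adjGraph.dist u v) :
    ∃ c : ℕ → Finset V,
      (∀ i < w.length, c i ∈ G.edges ∧ w.getVert i ∈ c i ∧ w.getVert (i + 1) ∈ c i) ∧
      Set.InjOn c (Set.Iio w.length) := by
  have hstep : ∀ i, ∃ c, i < w.length →
      c ∈ G.edges ∧ w.getVert i ∈ c ∧ w.getVert (i + 1) ∈ c := fun i => by
    by_cases hi : i < w.length
    · exact (w.adj_getVert_succ hi).2.imp fun c hc _ => hc
    · exact ⟨∅, fun h => absurd h hi⟩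
  choose c hc using hstep
  have hne : ∀ i j, i < j → j < w.length → c i ≠ c j := fun i j hij hj heq => by
    have hvert : w.getVert i ≠ w.getVert (j + 1) := fun h => by
      have := (w.isPath_of_length_eq_dist hw).getVert_injOn (Set.mem_ofPred.2 (by omega))
        (Set.mem_ofPred.2 (by omega)) h
      omega
    -- A repeated edge would be a shortcut.
    have hadj : G.adjGraph.Adj (w.getVert i) (w.getVert (j + 1)) :=
      ⟨hvert, c i, (hc i (hij.trans hj)).1, (hc i (hij.trans hj)).2.1, heq ▸ (hc j hj).2.2⟩
    have hshort := SimpleGraph.dist_le ((w.take i).append (.cons hadj (w.drop (j + 1))))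
    simp only [SimpleGraph.Walk.length_append, SimpleGraph.Walk.length_cons,
      SimpleGraph.Walk.take_length, SimpleGraph.Walk.drop_length] at hshort
    omega
  refine ⟨c, hc, fun i hi j hj hij => ?_⟩
  rcases lt_trichotomy i j with hlt | heq | hgt
  · exact absurd hij (hne i j hlt hj)
  · exact heq
  · exact absurd hij.symm (hne j i hgt hi)

theorem hasCycle_of_closing_edge {m : ℕ} {x : ℕ → V} {c : ℕ → Finset V}
    (hx : Set.InjOn x (Set.Iic (m + 1))) (hc : Set.InjOn c (Set.Iio (m + 1)))
    (hstep : ∀ i < m + 1, c i ∈ G.edges ∧ x i ∈ c i ∧ x (i + 1) ∈ c i)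
    (he : e ∈ G.edges) (hce : ∀ i < m + 1, c i ≠ e) (hfirst : x 0 ∈ e) (hlast : x (m + 1) ∈ e) :
    G.HasCycle := by
  refine ⟨m, fun i => x i, Fin.snoc (fun i : Fin (m + 1) => c i) e,
    fun i j hij => Fin.ext (hx (Set.mem_Iic.2 (by omega)) (Set.mem_Iic.2 (by omega)) hij),
    Fin.snoc_injective_iff.2 ⟨fun i j hij => Fin.ext (hc i.2 j.2 hij), ?_⟩, fun i => ?_⟩
  · rintro ⟨i, hi⟩
    exact hce i i.2 hi
  · cases i using Fin.lastCases with
    | last => simpa using ⟨he, hlast, hfirst⟩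
    | cast i => simpa using hstep i i.2

theorem hasCycle_of_linked_ne (he : e ∈ G.edges) (hu : u ∈ e) (hv : v ∈ e) (huv : u ≠ v)
    (h : G.Linked (· ≠ e) u v) : G.HasCycle := by
  obtain ⟨w, hw⟩ := SimpleGraph.Reachable.exists_walk_length_eq_dist h
  obtain ⟨c, hstep, hinj⟩ := exists_edges_of_length_eq_dist w hw
  obtain ⟨m, hm⟩ : ∃ m, w.length = m + 1 :=
    Nat.exists_eq_succ_of_ne_zero fun h0 => huv (SimpleGraph.Walk.eq_of_length_eq_zero h0)
  have hpath : Set.InjOn w.getVert (Set.Iic w.length) :=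
    (w.isPath_of_length_eq_dist hw).getVert_injOn
  have hmem : ∀ i < w.length, c i ∈ G.edges ∧ c i ≠ e := fun i hi =>
    mem_restrict_edges.1 (hstep i hi).1
  rw [hm] at hstep hinj hpath hmem
  exact hasCycle_of_closing_edge hpath hinj (fun i hi => ⟨(hmem i hi).1, (hstep i hi).2⟩) he
    (fun i hi => (hmem i hi).2) (by simpa using hu) (by simpa [← hm] using hv)

end Linked

/-! ### Rooted hypergraphs -/

section Rooted

variable {V : Type u} {G : FinHypergraph V} {root : V} {e e' : Finset V} {v x y : V}

@[simp]
theorem height_root : G.height root root = 0 :=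
  SimpleGraph.dist_self

theorem height_le_height_add_one (hG : G.adjGraph.Connected) (he : e ∈ G.edges) (hx : x ∈ e)
    (hy : y ∈ e) : G.height root x ≤ G.height root y + 1 := by
  by_cases h : x = y
  · simp [h]
  · have hxy : G.adjGraph.dist x y = 1 := SimpleGraph.dist_eq_one_iff_adj.2 ⟨h, e, he, hx, hy⟩
    have htri := hG.dist_triangle (u := x) (v := y) (w := root)
    unfold height
    omega

theorem exists_edge_height_lt (hG : G.adjGraph.Connected) (hv : v ≠ root) :
    ∃ e ∈ G.edges, v ∈ e ∧ ∃ p ∈ e, G.height root p < G.height root v := by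
  obtain ⟨w, hw⟩ := hG.exists_walk_length_eq_dist v root
  cases w with
  | nil => exact absurd rfl hv
  | @cons _ p _ hadj w' =>
    rw [SimpleGraph.Walk.length_cons] at hw
    obtain ⟨-, e, he, hx, hy⟩ := hadj
    refine ⟨e, he, hx, p, hy, ?_⟩
    calc G.height root p ≤ w'.length := SimpleGraph.dist_le w'
      _ < w'.length + 1 := Nat.lt_succ_self _
      _ = G.height root v := hw

open Classical in
/-- The apex of an edge: a vertex of the edge at minimal distance from the root. In a supertree it
is unique, and it is the parent of all other vertices of the edge. -/
noncomputable def apex (G : FinHypergraph V) (root : V) (e : Finset V) : V :=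
  if h : e.Nonempty then (e.exists_min_image (G.height root) h).choose else root

theorem apex_mem (he : e ∈ G.edges) : G.apex root e ∈ e := by
  have h := G.nonempty_of_mem e he
  rw [apex, dif_pos h]
  exact (e.exists_min_image (G.height root) h).choose_spec.1

theorem height_apex_le (hx : x ∈ e) : G.height root (G.apex root e) ≤ G.height root x := by
  have h : e.Nonempty := ⟨x, hx⟩
  rw [apex, dif_pos h]
  exact (e.exists_min_image (G.height root) h).choose_spec.2 x hx

/-- The parent edge of a vertex: an edge containing it and having its apex closer to the root.
The value at the root itself is arbitrary. -/
noncomputable def parentEdge (G : FinHypergraph V) (root v : V) : Finset V :=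
  Classical.epsilon fun e =>
    e ∈ G.edges ∧ v ∈ e ∧ G.height root (G.apex root e) < G.height root v

/-- The parent of a vertex other than the root, as a function. -/
noncomputable def parent (G : FinHypergraph V) (root v : V) : V :=
  G.apex root (G.parentEdge root v)

theorem parentEdge_spec (hG : G.adjGraph.Connected) (hv : v ≠ root) :
    G.parentEdge root v ∈ G.edges ∧ v ∈ G.parentEdge root v ∧
      G.height root (G.parent root v) < G.height root v := by
  obtain ⟨e, he, hve, p, hp, hlt⟩ := exists_edge_height_lt hG hv
  exact Classical.epsilon_spec
    (p := fun e => e ∈ G.edges ∧ v ∈ e ∧ G.height root (G.apex root e) < G.height root v)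
    ⟨e, he, hve, (height_apex_le hp).trans_lt hlt⟩

theorem parentEdge_mem_edges (hG : G.adjGraph.Connected) (hv : v ≠ root) :
    G.parentEdge root v ∈ G.edges :=
  (parentEdge_spec hG hv).1

theorem mem_parentEdge (hG : G.adjGraph.Connected) (hv : v ≠ root) : v ∈ G.parentEdge root v :=
  (parentEdge_spec hG hv).2.1

theorem parent_mem_parentEdge (hG : G.adjGraph.Connected) (hv : v ≠ root) :
    G.parent root v ∈ G.parentEdge root v :=
  apex_mem (parentEdge_mem_edges hG hv)

theorem height_eq_height_parent_add_one (hG : G.adjGraph.Connected) (hv : v ≠ root) :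
    G.height root v = G.height root (G.parent root v) + 1 :=
  le_antisymm
    (height_le_height_add_one hG (parentEdge_mem_edges hG hv) (mem_parentEdge hG hv)
      (parent_mem_parentEdge hG hv))
    (parentEdge_spec hG hv).2.2

theorem ne_parent (hG : G.adjGraph.Connected) (hv : v ≠ root) : v ≠ G.parent root v := fun h => by
  have := height_eq_height_parent_add_one hG hv
  rw [← h] at this
  omega

theorem ne_root_of_ne_apex (hG : G.adjGraph.Connected) (hx : x ∈ e) (hxe : x ≠ G.apex root e) :
    x ≠ root := by
  rintro rfl
  have h := height_apex_le (G := G) (root := x) hx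
  rw [height_root, Nat.le_zero] at h
  exact hxe (hG.dist_eq_zero_iff.1 h).symm

theorem linked_root (hG : G.adjGraph.Connected) (v : V) :
    G.Linked (fun e => ∃ p ∈ e, G.height root p < G.height root v) v root := by
  induction hn : G.height root v using Nat.strong_induction_on generalizing v with
  | _ n ih =>
    by_cases hv : v = root
    · exact hv ▸ .refl _
    · obtain ⟨e, he, hve, p, hp, hlt⟩ := exists_edge_height_lt hG hv
      refine (linked_of_mem_edge he ⟨p, hp, hn ▸ hlt⟩ hve hp).trans
        ((ih _ (hn ▸ hlt) p rfl).mono ?_)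
      rintro e - ⟨q, hq, hqp⟩
      exact ⟨q, hq, by omega⟩

theorem linked_root_ne (hG : G.adjGraph.Connected)
    (hv : G.height root v ≤ G.height root (G.apex root e)) : G.Linked (· ≠ e) v root := by
  refine (linked_root hG v).mono ?_
  rintro _ - ⟨p, hp, hlt⟩ rfl
  exact absurd (hv.trans (height_apex_le hp)) hlt.not_ge

end Rooted

/-! ### Rooted supertrees -/

section RootedSupertree

variable {V : Type u} {G : FinHypergraph V} {root : V} {e e' : Finset V} {v p q c x : V}

theorem IsSupertree.height_eq (hG : G.IsSupertree) (he : e ∈ G.edges) (hx : x ∈ e)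
    (hxe : x ≠ G.apex root e) : G.height root x = G.height root (G.apex root e) + 1 := by
  have hle := height_le_height_add_one (root := root) hG.1 he hx (apex_mem (root := root) he)
  refine hle.eq_or_lt.resolve_right fun hlt => hG.2 ?_
  exact hasCycle_of_linked_ne he hx (apex_mem he) hxe
    ((linked_root_ne hG.1 (Nat.lt_succ_iff.1 hlt)).trans (linked_root_ne hG.1 le_rfl).symm)

theorem IsSupertree.edge_eq (hG : G.IsSupertree) (he : e ∈ G.edges) (he' : e' ∈ G.edges)
    (hx : x ∈ e) (hx' : x ∈ e') (hxe : x ≠ G.apex root e) (hxe' : x ≠ G.apex root e') :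
    e' = e := by
  have h := hG.height_eq he hx hxe
  have h' := hG.height_eq he' hx' hxe'
  by_contra hne
  refine hG.2 (hasCycle_of_linked_ne he hx (apex_mem he) hxe ?_)
  exact ((linked_of_mem_edge he' hne hx' (apex_mem (root := root) he')).trans
    (linked_root_ne hG.1 (by omega))).trans (linked_root_ne hG.1 le_rfl).symm

theorem IsSupertree.parentEdge_eq (hG : G.IsSupertree) (he : e ∈ G.edges) (hx : x ∈ e)
    (hxe : x ≠ G.apex root e) : G.parentEdge root x = e :=
  have hx0 := ne_root_of_ne_apex hG.1 hx hxe
  hG.edge_eq he (parentEdge_mem_edges hG.1 hx0) hx (mem_parentEdge hG.1 hx0) hxe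
    (ne_parent hG.1 hx0)

theorem IsSupertree.parent_eq (hG : G.IsSupertree) (he : e ∈ G.edges) (hx : x ∈ e)
    (hxe : x ≠ G.apex root e) : G.parent root x = G.apex root e := by
  rw [parent, hG.parentEdge_eq he hx hxe]

/-- Among the edges of a cycle, one whose apex is highest meets both of its neighbours in the
apex only. -/
theorem isSupertree_of_parentEdge_eq (hG : G.adjGraph.Connected)
    (h : ∀ e ∈ G.edges, ∀ x ∈ e, x ≠ G.apex root e → G.parentEdge root x = e) :
    G.IsSupertree := by
  refine ⟨hG, ?_⟩
  rintro ⟨m, x, e, hx, he, hstep⟩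
  obtain ⟨i, -, hi⟩ := (Finset.univ : Finset (Fin (m + 2))).exists_max_image
    (fun i => G.height root (G.apex root (e i))) ⟨0, Finset.mem_univ _⟩
  have hmeet : ∀ j, e j ≠ e i → ∀ y ∈ e i, y ∈ e j → y = G.apex root (e i) := by
    intro j hj y hyi hyj
    by_contra hy
    have hpar := h _ (hstep i).1 y hyi hy
    by_cases hy' : y = G.apex root (e j)
    · have hlt := (parentEdge_spec hG (ne_root_of_ne_apex hG hyi hy)).2.2
      rw [parent, hpar, hy'] at hlt
      exact absurd (hi j (Finset.mem_univ _)) hlt.not_ge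
    · exact hj ((h _ (hstep j).1 y hyj hy').symm.trans hpar)
  have hnext : x (i + 1) = G.apex root (e i) :=
    hmeet (i + 1) (he.ne (by simp)) _ (hstep i).2.2 (hstep (i + 1)).2.1
  have hprev : x i = G.apex root (e i) :=
    hmeet (i - 1) (he.ne (by simp)) _ (hstep i).2.1 (by simpa using (hstep (i - 1)).2.2)
  simpa using hx (hprev.trans hnext.symm)

theorem IsSupertree.isParent_iff (hG : G.IsSupertree) :
    G.IsParent root p c ↔ c ≠ root ∧ p = G.parent root c := by
  constructor
  · rintro ⟨⟨-, e, he, hp, hc⟩, h⟩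
    have hce : c ≠ G.apex root e := by
      rintro rfl
      have := height_apex_le (G := G) (root := root) hp
      omega
    refine ⟨ne_root_of_ne_apex hG.1 hc hce, ?_⟩
    rw [hG.parent_eq he hc hce]
    by_contra hpe
    have := hG.height_eq he hp hpe
    have := hG.height_eq he hc hce
    omega
  · rintro ⟨hc, rfl⟩
    exact ⟨⟨(ne_parent hG.1 hc).symm, _, parentEdge_mem_edges hG.1 hc,
      parent_mem_parentEdge hG.1 hc, mem_parentEdge hG.1 hc⟩,
      height_eq_height_parent_add_one hG.1 hc⟩

theorem IsBoundary.edge_eq [DecidableEq V] (hv : G.IsBoundary v) (he : e ∈ G.edges)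
    (he' : e' ∈ G.edges) (h : v ∈ e) (h' : v ∈ e') : e = e' :=
  Finset.card_le_one.1 (le_of_eq hv) e (Finset.mem_filter.2 ⟨he, h⟩) e'
    (Finset.mem_filter.2 ⟨he', h'⟩)

end RootedSupertree

/-! ### Counting vertices along parent edges -/

section Count

variable {V : Type u} [Fintype V] {G : FinHypergraph V}

section

variable [DecidableEq V] {root : V} {e : Finset V}

theorem filter_parentEdge_subset (hG : G.adjGraph.Connected) :
    ({v | v ≠ root ∧ G.parentEdge root v = e} : Finset V) ⊆ e.erase (G.apex root e) := by
  intro v hv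
  obtain ⟨hv0, rfl⟩ := (Finset.mem_filter.1 hv).2
  exact Finset.mem_erase.2 ⟨ne_parent hG hv0, mem_parentEdge hG hv0⟩

theorem IsSupertree.filter_parentEdge_eq (hG : G.IsSupertree) (he : e ∈ G.edges) :
    ({v | v ≠ root ∧ G.parentEdge root v = e} : Finset V) = e.erase (G.apex root e) := by
  refine (filter_parentEdge_subset hG.1).antisymm fun v hv => ?_
  obtain ⟨hve, hv⟩ := Finset.mem_erase.1 hv
  simpa using ⟨ne_root_of_ne_apex hG.1 hv hve, hG.parentEdge_eq he hv hve⟩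

theorem card_filter_parentEdge_le (hG : G.adjGraph.Connected) (he : e ∈ G.edges) :
    ({v | v ≠ root ∧ G.parentEdge root v = e} : Finset V).card ≤ e.card - 1 :=
  Finset.card_erase_of_mem (apex_mem (root := root) he) ▸
    Finset.card_le_card (filter_parentEdge_subset hG)

theorem card_eq_sum_card_filter_parentEdge (hG : G.adjGraph.Connected) (root : V) :
    Fintype.card V =
      ∑ e ∈ G.edges, ({v | v ≠ root ∧ G.parentEdge root v = e} : Finset V).card + 1 := by
  have hfib := Finset.card_eq_sum_card_fiberwise (s := Finset.univ.erase root) (t := G.edges)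
    (f := G.parentEdge root) fun v hv => parentEdge_mem_edges hG (Finset.ne_of_mem_erase hv)
  rw [Finset.card_erase_of_mem (Finset.mem_univ _), Finset.card_univ] at hfib
  have hpos : 0 < Fintype.card V := Fintype.card_pos_iff.2 ⟨root⟩
  have hfilter : ∀ e, {v ∈ Finset.univ.erase root | G.parentEdge root v = e} =
      ({v | v ≠ root ∧ G.parentEdge root v = e} : Finset V) := fun e => by ext; simp
  simp only [hfilter] at hfib
  omega

end

theorem card_le_of_connected (hG : G.adjGraph.Connected) :
    Fintype.card V ≤ ∑ e ∈ G.edges, (e.card - 1) + 1 := by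
  classical
  obtain ⟨root⟩ := hG.nonempty
  rw [card_eq_sum_card_filter_parentEdge hG root]
  exact Nat.add_le_add_right (Finset.sum_le_sum fun e he => card_filter_parentEdge_le hG he) 1

theorem isSupertree_of_card_eq (hG : G.adjGraph.Connected)
    (h : Fintype.card V = ∑ e ∈ G.edges, (e.card - 1) + 1) : G.IsSupertree := by
  classical
  obtain ⟨root⟩ := hG.nonempty
  rw [card_eq_sum_card_filter_parentEdge hG root] at h
  have hcard := (Finset.sum_eq_sum_iff_of_le fun e he => card_filter_parentEdge_le hG he).1
    (Nat.add_right_cancel h)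
  refine isSupertree_of_parentEdge_eq (root := root) hG fun e he x hx hxe => ?_
  have hfib := Finset.eq_of_subset_of_card_le (filter_parentEdge_subset (e := e) hG)
    (by rw [hcard e he, Finset.card_erase_of_mem (apex_mem he)])
  exact (Finset.mem_filter.1 (hfib.symm ▸ Finset.mem_erase.2 ⟨hxe, hx⟩)).2.2

theorem IsSupertree.card_eq (hG : G.IsSupertree) :
    Fintype.card V = ∑ e ∈ G.edges, (e.card - 1) + 1 := by
  classical
  obtain ⟨root⟩ := hG.1.nonempty
  rw [card_eq_sum_card_filter_parentEdge hG.1 root]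
  refine congrArg (· + 1) (Finset.sum_congr rfl fun e he => ?_)
  rw [hG.filter_parentEdge_eq he, Finset.card_erase_of_mem (apex_mem he)]

end Count

/-! ### Descendants -/

section Descendants

variable {V : Type u} {G : FinHypergraph V} {root : V} {e e₁ e₂ : Finset V} {v q x : V}

/-- `v` descends from `q`, with respect to a root; every vertex descends from itself. -/
def IsDescendant (G : FinHypergraph V) (root v q : V) : Prop :=
  Relation.ReflTransGen (fun x y => G.IsParent root y x) v q

theorem IsDescendant.height_le (h : G.IsDescendant root v q) :
    G.height root q ≤ G.height root v := by
  induction h with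
  | refl => exact le_rfl
  | tail _ hpar ih => exact (Nat.le_succ _).trans (hpar.2.symm.trans_le ih)

theorem IsDescendant.linked (hG : G.IsSupertree) (h : G.IsDescendant root v q) :
    G.Linked (fun e => G.height root q ≤ G.height root (G.apex root e) ∧
      G.height root (G.apex root e) < G.height root v) v q := by
  induction h using Relation.ReflTransGen.head_induction_on with
  | refl => exact .refl _
  | head hpar hdesc ih =>
    obtain ⟨hx, rfl⟩ := hG.isParent_iff.1 hpar
    have hlt := (parentEdge_spec hG.1 hx).2.2
    refine (linked_of_mem_edge (parentEdge_mem_edges hG.1 hx)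
      ⟨IsDescendant.height_le hdesc, hlt⟩ (mem_parentEdge hG.1 hx)
      (parent_mem_parentEdge hG.1 hx)).trans (ih.mono ?_)
    rintro e - ⟨hq, he⟩
    exact ⟨hq, he.trans hlt⟩

theorem IsSupertree.isDescendant_apex (hG : G.IsSupertree) (he : e ∈ G.edges) (hx : x ∈ e) :
    G.IsDescendant root x (G.apex root e) := by
  by_cases h : x = G.apex root e
  · rw [← h]
    exact .refl
  · exact .single (hG.isParent_iff.2 ⟨ne_root_of_ne_apex hG.1 hx h, (hG.parent_eq he hx h).symm⟩)

theorem IsSupertree.isParent_parent (hG : G.IsSupertree) (hv : v ≠ root) :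
    G.IsParent root (G.parent root v) v :=
  hG.isParent_iff.2 ⟨hv, rfl⟩

theorem IsSupertree.isDescendant_root (hG : G.IsSupertree) (v : V) :
    G.IsDescendant root v root := by
  induction hn : G.height root v using Nat.strong_induction_on generalizing v with
  | _ n ih =>
    by_cases hv : v = root
    · exact hv ▸ .refl
    · exact .head (hG.isParent_parent hv) (ih _ (hn ▸ (parentEdge_spec hG.1 hv).2.2) _ rfl)

theorem IsSupertree.isDescendant_or_linked_root (hG : G.IsSupertree) (e : Finset V) (v : V) :
    (∃ q ∈ e, q ≠ G.apex root e ∧ G.IsDescendant root v q) ∨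
      G.Linked (fun c => G.height root (G.apex root c) < G.height root v ∧ c ≠ e) v root := by
  induction hn : G.height root v using Nat.strong_induction_on generalizing v with
  | _ n ih =>
    by_cases hv : v = root
    · exact .inr (hv ▸ .refl _)
    have hlt := hn ▸ (parentEdge_spec hG.1 hv).2.2
    by_cases hpe : G.parentEdge root v = e
    · exact .inl ⟨v, hpe ▸ mem_parentEdge hG.1 hv, hpe ▸ ne_parent hG.1 hv, .refl⟩
    rcases ih _ hlt (G.parent root v) rfl with ⟨q, hq, hqe, hdesc⟩ | hlink
    · exact .inl ⟨q, hq, hqe, .head (hG.isParent_parent hv) hdesc⟩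
    · refine .inr ((linked_of_mem_edge (parentEdge_mem_edges hG.1 hv) ⟨hlt, hpe⟩
        (mem_parentEdge hG.1 hv) (parent_mem_parentEdge hG.1 hv)).trans (hlink.mono ?_))
      rintro c - ⟨hc, hce⟩
      exact ⟨hc.trans hlt, hce⟩

theorem IsSupertree.isDescendant_or_linked_apex (hG : G.IsSupertree)
    (h : G.height root (G.apex root e₂) ≤ G.height root (G.apex root e₁)) :
    (∃ q ∈ e₂, q ≠ G.apex root e₂ ∧ G.IsDescendant root (G.apex root e₁) q) ∨
      G.Linked (fun c => c ≠ e₁ ∧ c ≠ e₂) (G.apex root e₁) (G.apex root e₂) := by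
  rcases hG.isDescendant_or_linked_root e₂ (G.apex root e₁) with hdesc | hlink
  · exact .inl hdesc
  refine .inr ((hlink.mono ?_).trans
    (((hG.isDescendant_root (G.apex root e₂)).linked hG).mono ?_).symm)
  · rintro c - ⟨hc, hne⟩
    exact ⟨fun h => absurd (h ▸ hc) (lt_irrefl _), hne⟩
  · rintro c - ⟨-, hc⟩
    exact ⟨fun hce => absurd (hce ▸ hc) h.not_gt, fun hce => absurd (hce ▸ hc) (lt_irrefl _)⟩

theorem IsDescendant.ne_and_linked_ne (hG : G.IsSupertree) (he₂ : e₂ ∈ G.edges) (hq : q ∈ e₂)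
    (hqe : q ≠ G.apex root e₂) (hdesc : G.IsDescendant root (G.apex root e₁) q) :
    e₁ ≠ e₂ ∧ G.Linked (fun c => c ≠ e₁ ∧ c ≠ e₂) (G.apex root e₁) q := by
  have hheight := hG.height_eq he₂ hq hqe
  have hle := hdesc.height_le
  refine ⟨fun h => by subst h; omega, (hdesc.linked hG).mono ?_⟩
  rintro c - ⟨hqc, hc⟩
  exact ⟨fun h => by subst h; omega, fun h => by subst h; omega⟩

end Descendants

end FinHypergraph

namespace FinHypergraph

/-! ### The Laplacian and its energy -/

section Energy

variable {V : Type u}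

/-- `(k - 1) L f` for a `k`-uniform hypergraph with Laplacian `L`, as a sum over the edges at a
vertex. Working with `(k - 1) L` avoids denominators. -/
noncomputable def lapSum [DecidableEq V] (G : FinHypergraph V) (k : ℕ) (f : V → ℝ) (v : V) : ℝ :=
  ∑ e ∈ G.edges with v ∈ e, (k * f v - ∑ x ∈ e, f x)

/-- The contribution of a single edge to the quadratic form of `(k - 1) L`. -/
noncomputable def edgeEnergy (k : ℕ) (f : V → ℝ) (e : Finset V) : ℝ :=
  k * ∑ x ∈ e, f x ^ 2 - (∑ x ∈ e, f x) ^ 2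

/-- The quadratic form of `(k - 1) L`; minimizing it gives the first Dirichlet eigenvalue. -/
noncomputable def energy (G : FinHypergraph V) (k : ℕ) (f : V → ℝ) : ℝ :=
  ∑ e ∈ G.edges, edgeEnergy k f e

theorem energy_smul (G : FinHypergraph V) (k : ℕ) (c : ℝ) (f : V → ℝ) :
    G.energy k (c • f) = c ^ 2 * G.energy k f := by
  simp only [energy, edgeEnergy, Finset.mul_sum, Pi.smul_apply, smul_eq_mul, mul_pow]
  refine Finset.sum_congr rfl fun e _ => ?_
  simp only [← Finset.mul_sum]
  ring

theorem continuous_energy (G : FinHypergraph V) (k : ℕ) :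
    Continuous fun f : V → ℝ => G.energy k f := by
  unfold energy edgeEnergy
  fun_prop

theorem energy_abs_le (G : FinHypergraph V) (k : ℕ) (f : V → ℝ) :
    G.energy k |f| ≤ G.energy k f := by
  refine Finset.sum_le_sum fun e _ => ?_
  simp only [edgeEnergy, Pi.abs_apply, sq_abs]
  gcongr ?_ - ?_
  exact sq_le_sq.2 ((Finset.abs_sum_le_sum_abs f e).trans (le_abs_self _))

variable [DecidableEq V]

theorem lapSum_eq_sum_ite (G : FinHypergraph V) (k : ℕ) (f : V → ℝ) (v : V) :
    G.lapSum k f v = ∑ e ∈ G.edges, if v ∈ e then k * f v - ∑ x ∈ e, f x else 0 :=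
  Finset.sum_filter _ _

theorem energy_add_single (G : FinHypergraph V) (k : ℕ) (f : V → ℝ) (v : V) (t : ℝ) :
    G.energy k (f + t • Pi.single v 1) =
      G.energy k f + 2 * t * G.lapSum k f v + t ^ 2 * G.energy k (Pi.single v 1) := by
  simp only [lapSum_eq_sum_ite, energy, Finset.mul_sum, ← Finset.sum_add_distrib]
  refine Finset.sum_congr rfl fun e _ => ?_
  have hsum : ∑ x ∈ e, (Pi.single v (1 : ℝ) : V → ℝ) x = if v ∈ e then 1 else 0 := by
    simp [Pi.single_apply]
  have hcross : ∑ x ∈ e, f x * (t * (Pi.single v (1 : ℝ) : V → ℝ) x) =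
      if v ∈ e then t * f v else 0 := by
    simp [Pi.single_apply, mul_comm]
  simp only [edgeEnergy, Pi.add_apply, Pi.smul_apply, smul_eq_mul, add_sq, mul_pow,
    Finset.sum_add_distrib, ← Finset.mul_sum, mul_assoc, hcross, hsum]
  split_ifs <;> ring

variable [Fintype V]

theorem sum_mul_lapSum (G : FinHypergraph V) (k : ℕ) (f g : V → ℝ) :
    ∑ v, g v * G.lapSum k f v =
      ∑ e ∈ G.edges, (k * ∑ x ∈ e, f x * g x - (∑ x ∈ e, f x) * ∑ x ∈ e, g x) := by
  have hterm (v : V) (e : Finset V) :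
      (g v * if v ∈ e then k * f v - ∑ x ∈ e, f x else 0) =
        if v ∈ e then k * (f v * g v) - (∑ x ∈ e, f x) * g v else 0 := by
    split_ifs <;> ring
  simp only [lapSum_eq_sum_ite, Finset.mul_sum, hterm]
  rw [Finset.sum_comm]
  refine Finset.sum_congr rfl fun e _ => ?_
  rw [Finset.sum_ite_mem, Finset.univ_inter, Finset.sum_sub_distrib]

theorem sum_mul_lapSum_self (G : FinHypergraph V) (k : ℕ) (f : V → ℝ) :
    ∑ v, f v * G.lapSum k f v = G.energy k f := by
  simp only [sum_mul_lapSum, energy, edgeEnergy, sq]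

theorem adjMatrix_mulVec {G : FinHypergraph V} {k : ℕ} (hG : G.IsUniform k) (f : V → ℝ) (v : V) :
    G.adjMatrix.mulVec f v =
      ∑ e ∈ G.edges with v ∈ e, 1 / ((k : ℝ) - 1) * (∑ x ∈ e, f x - f v) := by
  have hterm : ∀ e ∈ G.edges.filter (v ∈ ·), 1 / ((k : ℝ) - 1) * (∑ x ∈ e, f x - f v) =
      ∑ j, if j ∈ e.erase v then 1 / ((e.card : ℝ) - 1) * f j else 0 := by
    intro e he
    obtain ⟨he, hv⟩ := Finset.mem_filter.1 he
    rw [Finset.sum_ite_mem, Finset.univ_inter, ← Finset.mul_sum, hG e he,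
      ← Finset.sum_erase_add e f hv, add_sub_cancel_right]
  rw [Finset.sum_congr rfl hterm, Finset.sum_comm]
  refine Finset.sum_congr rfl fun j _ => ?_
  by_cases hvj : v = j
  · simp [adjMatrix, hvj]
  · simp only [adjMatrix, Matrix.of_apply, if_neg hvj, Finset.mem_erase, Ne.symm hvj, ne_eq,
      not_false_eq_true, true_and]
    rw [Finset.sum_mul, ← Finset.sum_filter, Finset.filter_filter]

theorem lapMatrix_mulVec {G : FinHypergraph V} {k : ℕ} (hk : 2 ≤ k) (hG : G.IsUniform k)
    (f : V → ℝ) (v : V) : ((k : ℝ) - 1) * G.lapMatrix.mulVec f v = G.lapSum k f v := by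
  have hk' : (k : ℝ) - 1 ≠ 0 := sub_ne_zero.2 (by exact_mod_cast (show k ≠ 1 by omega))
  rw [lapMatrix, Matrix.sub_mulVec, Pi.sub_apply, Matrix.mulVec_diagonal, adjMatrix_mulVec hG,
    lapSum, ← Finset.mul_sum, mul_sub, ← mul_assoc _ (1 / _), mul_one_div_cancel hk', one_mul,
    Finset.sum_sub_distrib, Finset.sum_sub_distrib, Finset.sum_const, Finset.sum_const, degree]
  simp only [nsmul_eq_mul]
  ring

end Energy

/-! ### The variational characterization of the first Dirichlet eigenvalue -/

section Variational

variable {V : Type u} [DecidableEq V] {G : FinHypergraph V} {k : ℕ} {f g : V → ℝ} {m : ℝ}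
  {v : V}

/-- The boundary condition of the Dirichlet problem. -/
def VanishesOnBoundary (G : FinHypergraph V) (f : V → ℝ) : Prop :=
  ∀ v, G.IsBoundary v → f v = 0

theorem vanishesOnBoundary_single (hv : ¬ G.IsBoundary v) (c : ℝ) :
    G.VanishesOnBoundary (Pi.single v c) := fun w hw => by
  obtain rfl | hwv := eq_or_ne w v
  exacts [absurd hw hv, Pi.single_eq_of_ne (M := fun _ => ℝ) hwv c]

variable [Fintype V]

/-- `f` is a normalized minimizer of the Rayleigh quotient of the Dirichlet problem. -/
structure IsRayleighMinimizer (G : FinHypergraph V) (k : ℕ) (f : V → ℝ) : Prop where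
  vanishes : G.VanishesOnBoundary f
  sum_sq_eq_one : ∑ v, f v ^ 2 = 1
  energy_mul_le : ∀ g : V → ℝ, G.VanishesOnBoundary g → G.energy k f * ∑ v, g v ^ 2 ≤ G.energy k g

theorem isCompact_setOf_sum_sq_eq_one (ι : Type*) [Fintype ι] :
    IsCompact {f : ι → ℝ | ∑ i, f i ^ 2 = 1} := by
  refine Metric.isCompact_of_isClosed_isBounded
    (isClosed_eq (by fun_prop) continuous_const)
    ((Metric.isBounded_closedBall (x := (0 : ι → ℝ)) (r := 1)).subset fun f hf => ?_)
  rw [mem_closedBall_zero_iff, pi_norm_le_iff_of_nonneg zero_le_one]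
  intro i
  rw [Real.norm_eq_abs, ← sq_le_one_iff_abs_le_one, ← Set.mem_ofPred.1 hf]
  exact Finset.single_le_sum (f := fun i => f i ^ 2) (fun j _ => sq_nonneg (f j))
    (Finset.mem_univ i)

theorem exists_isRayleighMinimizer (k : ℕ) (hG : ∃ v, ¬ G.IsBoundary v) :
    ∃ f, G.IsRayleighMinimizer k f := by
  obtain ⟨v, hv⟩ := hG
  have hclosed : IsClosed {f : V → ℝ | G.VanishesOnBoundary f} := by
    simp only [VanishesOnBoundary, Set.ofPred_forall]
    exact isClosed_iInter fun v => isClosed_iInter fun _ =>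
      isClosed_eq (continuous_apply v) continuous_const
  obtain ⟨f, ⟨hf1, hf0⟩, hmin⟩ :=
    ((isCompact_setOf_sum_sq_eq_one V).inter_right hclosed).exists_isMinOn
      ⟨Pi.single v 1, by simp [Pi.single_apply], vanishesOnBoundary_single hv 1⟩
      (G.continuous_energy k).continuousOn
  refine ⟨f, hf0, hf1, fun g hg => ?_⟩
  have hnonneg : 0 ≤ ∑ v, g v ^ 2 := Finset.sum_nonneg fun _ _ => sq_nonneg _
  rcases hnonneg.eq_or_lt with hzero | hpos
  · have hg0 : g = 0 := funext fun v => by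
      simpa using (Finset.sum_eq_zero_iff_of_nonneg fun i _ => sq_nonneg (g i)).1 hzero.symm v
        (Finset.mem_univ v)
    simp [hg0, energy, edgeEnergy]
  · set s := √(∑ v, g v ^ 2)
    have hs : 0 < s := Real.sqrt_pos.2 hpos
    have hs2 : ∑ v, g v ^ 2 = s ^ 2 := (Real.sq_sqrt hnonneg).symm
    have hnormalized : G.energy k f ≤ G.energy k (s⁻¹ • g) :=
      hmin ⟨by
        simp only [Set.mem_ofPred_eq, Pi.smul_apply, smul_eq_mul, mul_pow, ← Finset.mul_sum, hs2]
        field_simp, fun v hv => by simp [hg v hv]⟩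
    rw [energy_smul] at hnormalized
    calc G.energy k f * ∑ v, g v ^ 2 ≤ (s⁻¹ ^ 2 * G.energy k g) * s ^ 2 := by rw [hs2]; gcongr
      _ = G.energy k g := by field_simp

theorem sum_sq_add_single (f : V → ℝ) (v : V) (t : ℝ) :
    ∑ w, (f + t • Pi.single v (1 : ℝ) : V → ℝ) w ^ 2 = ∑ w, f w ^ 2 + 2 * t * f v + t ^ 2 := by
  have hterm : ∀ w, (f + t • Pi.single v (1 : ℝ) : V → ℝ) w ^ 2 =
      f w ^ 2 + if w = v then 2 * t * f w + t ^ 2 else 0 := by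
    intro w
    by_cases hw : w = v
    · subst hw
      simp only [Pi.add_apply, Pi.smul_apply, Pi.single_eq_same, smul_eq_mul, if_true]
      ring
    · simp [hw]
  simp only [hterm, Finset.sum_add_distrib, Finset.sum_ite_eq', Finset.mem_univ, if_true]
  ring

/-- The Rayleigh quotient is stationary at `f` in the direction of the indicator function of any
interior vertex. -/
theorem lapSum_eq_of_energy_le
    (hm : ∀ g : V → ℝ, G.VanishesOnBoundary g → m * ∑ v, g v ^ 2 ≤ G.energy k g)
    (hf0 : G.VanishesOnBoundary f) (hf : G.energy k f ≤ m * ∑ v, f v ^ 2)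
    (hv : ¬ G.IsBoundary v) : G.lapSum k f v = m * f v := by
  have hquad : ∀ t : ℝ, 0 ≤ (G.energy k (Pi.single v 1) - m) * (t * t) +
      (2 * (G.lapSum k f v - m * f v)) * t + 0 := by
    intro t
    have hle := hm (f + t • Pi.single v 1) fun w hw => by
      simp [hf0 w hw, vanishesOnBoundary_single hv 1 w hw]
    rw [energy_add_single, sum_sq_add_single] at hle
    linarith
  have hdiscrim := discrim_le_zero hquad
  have hsq : (2 * (G.lapSum k f v - m * f v)) ^ 2 = 0 :=
    le_antisymm (by simpa [discrim] using hdiscrim) (sq_nonneg _)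
  linarith [pow_eq_zero_iff two_ne_zero |>.1 hsq]

theorem energy_eq_of_lapSum_eq (hf0 : G.VanishesOnBoundary f)
    (hf : ∀ v, ¬ G.IsBoundary v → G.lapSum k f v = m * f v) :
    G.energy k f = m * ∑ v, f v ^ 2 := by
  rw [← sum_mul_lapSum_self, Finset.mul_sum]
  refine Finset.sum_congr rfl fun v _ => ?_
  by_cases hv : G.IsBoundary v
  · simp [hf0 v hv]
  · rw [hf v hv]
    ring

/-- The first Dirichlet eigenvalue times `k - 1`, the factor that relates `lapSum` and `energy` to
the Laplacian. -/
noncomputable def scaledEigenvalue (G : FinHypergraph V) (k : ℕ) : ℝ :=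
  ((k : ℝ) - 1) * G.firstDirichletEigenvalue

theorem IsRayleighMinimizer.scaledEigenvalue_eq (hk : 2 ≤ k) (hG : G.IsUniform k)
    (hf : G.IsRayleighMinimizer k f) : G.scaledEigenvalue k = G.energy k f := by
  have hk' : (0 : ℝ) < (k : ℝ) - 1 := sub_pos.2 (by exact_mod_cast hk)
  have hleast : IsLeast {μ : ℝ | G.IsDirichletEigenvalue μ} (G.energy k f / ((k : ℝ) - 1)) := by
    constructor
    · refine ⟨f, ?_, fun v hv => ?_, hf.vanishes⟩
      · rintro rfl
        simpa using hf.sum_sq_eq_one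
      · have hlap := lapSum_eq_of_energy_le hf.energy_mul_le hf.vanishes
          (by rw [hf.sum_sq_eq_one, mul_one]) hv
        rw [← lapMatrix_mulVec hk hG] at hlap
        field_simp
        linarith
    · rintro μ ⟨g, hg, heigen, hg0⟩
      obtain ⟨v, hv⟩ := Function.ne_iff.1 hg
      have hpos : 0 < ∑ v, g v ^ 2 := Finset.sum_pos' (fun i _ => sq_nonneg (g i))
        ⟨v, Finset.mem_univ v, sq_pos_of_ne_zero hv⟩
      have henergy : G.energy k g = ((k : ℝ) - 1) * μ * ∑ v, g v ^ 2 :=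
        energy_eq_of_lapSum_eq hg0 fun v hv => by
          rw [← lapMatrix_mulVec hk hG, heigen v hv, mul_assoc]
      rw [div_le_iff₀' hk']
      exact le_of_mul_le_mul_right (henergy ▸ hf.energy_mul_le g hg0) hpos
  rw [scaledEigenvalue, firstDirichletEigenvalue, hleast.csInf_eq]
  field_simp

theorem scaledEigenvalue_mul_le (hk : 2 ≤ k) (hG : G.IsUniform k) (hint : ∃ v, ¬ G.IsBoundary v)
    (hg : G.VanishesOnBoundary g) : G.scaledEigenvalue k * ∑ v, g v ^ 2 ≤ G.energy k g := by
  obtain ⟨f, hf⟩ := exists_isRayleighMinimizer k hint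
  rw [hf.scaledEigenvalue_eq hk hG]
  exact hf.energy_mul_le g hg

end Variational

/-! ### Ground states -/

section GroundState

variable {V : Type u} [DecidableEq V] {G : FinHypergraph V} {k : ℕ} {f : V → ℝ}
  {m : ℝ} {v w : V} {e : Finset V}

theorem eq_zero_of_lapSum_eq (hf : ∀ v, 0 ≤ f v) (hlap : G.lapSum k f v = m * f v)
    (hv : f v = 0) (he : e ∈ G.edges) (hve : v ∈ e) : ∀ x ∈ e, f x = 0 := by
  simp only [lapSum, hv, mul_zero, zero_sub, Finset.sum_neg_distrib, neg_eq_zero] at hlap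
  have hedge := (Finset.sum_eq_zero_iff_of_nonneg
    fun e _ => Finset.sum_nonneg fun x _ => hf x).1 hlap e (Finset.mem_filter.2 ⟨he, hve⟩)
  exact (Finset.sum_eq_zero_iff_of_nonneg fun x _ => hf x).1 hedge

/-- A minimum principle: zeros spread along the edges, since boundary vertices lie on one edge
only. -/
theorem eq_zero_of_connected (hc : G.adjGraph.Connected) (hf : ∀ v, 0 ≤ f v)
    (hlap : ∀ v, ¬ G.IsBoundary v → G.lapSum k f v = m * f v) (hv : ¬ G.IsBoundary v)
    (hfv : f v = 0) : f = 0 := by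
  suffices h : ∀ w, f w = 0 ∧ ∀ e ∈ G.edges, w ∈ e → ∀ x ∈ e, f x = 0 from
    funext fun w => (h w).1
  intro w
  obtain ⟨p⟩ := hc.preconnected w v
  induction p with
  | nil => exact ⟨hfv, fun e => eq_zero_of_lapSum_eq hf (hlap _ hv) hfv⟩
  | @cons a _ _ hadj _ ih =>
    obtain ⟨-, e, he, hae, hbe⟩ := hadj
    have hedge := (ih hv hfv).2 e he hbe
    refine ⟨hedge a hae, fun e' he' hae' => ?_⟩
    by_cases ha : G.IsBoundary a
    · rwa [ha.edge_eq he' he hae' hae]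
    · exact eq_zero_of_lapSum_eq hf (hlap a ha) (hedge a hae) he' hae'

variable [Fintype V]

/-- A Dirichlet eigenfunction for the first eigenvalue that is positive in the interior. -/
structure IsGroundState (G : FinHypergraph V) (k : ℕ) (f : V → ℝ) : Prop where
  vanishes : G.VanishesOnBoundary f
  pos : ∀ v, ¬ G.IsBoundary v → 0 < f v
  lapSum_eq : ∀ v, ¬ G.IsBoundary v → G.lapSum k f v = G.scaledEigenvalue k * f v

theorem IsGroundState.nonneg (hf : G.IsGroundState k f) (v : V) : 0 ≤ f v := by
  by_cases hv : G.IsBoundary v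
  · exact (hf.vanishes v hv).ge
  · exact (hf.pos v hv).le

theorem IsGroundState.not_isBoundary (hf : G.IsGroundState k f) (hv : 0 < f v) :
    ¬ G.IsBoundary v :=
  fun h => hv.ne' (hf.vanishes v h)

theorem IsGroundState.energy_eq (hf : G.IsGroundState k f) :
    G.energy k f = G.scaledEigenvalue k * ∑ v, f v ^ 2 :=
  energy_eq_of_lapSum_eq hf.vanishes hf.lapSum_eq

theorem exists_isGroundState (hk : 2 ≤ k) (hG : G.IsUniform k) (hc : G.adjGraph.Connected)
    (hint : ∃ v, ¬ G.IsBoundary v) : ∃ f, G.IsGroundState k f := by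
  obtain ⟨f, hf⟩ := exists_isRayleighMinimizer k hint
  have hvanish : G.VanishesOnBoundary |f| := fun v hv => by simp [hf.vanishes v hv]
  have hnorm : ∑ v, |f| v ^ 2 = 1 := by simpa using hf.sum_sq_eq_one
  have hlap : ∀ v, ¬ G.IsBoundary v → G.lapSum k |f| v = G.energy k f * |f| v := fun v hv =>
    lapSum_eq_of_energy_le hf.energy_mul_le hvanish
      (by rw [hnorm, mul_one]; exact G.energy_abs_le k f) hv
  refine ⟨|f|, hvanish, fun v hv => (abs_nonneg (f v)).lt_of_ne' fun hzero => ?_,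
    hf.scaledEigenvalue_eq hk hG ▸ hlap⟩
  have habs : |f| = 0 := eq_zero_of_connected hc (fun v => abs_nonneg (f v)) hlap hv hzero
  rw [habs] at hnorm
  simp at hnorm

end GroundState

end FinHypergraph

namespace FinHypergraph

/-! ### Exchanging two vertices between edges -/

section Exchange

variable {V : Type u} {G H : FinHypergraph V} {k : ℕ} {u v : V}

theorem connected_of_forall_edge (hG : G.adjGraph.Connected)
    (h : ∀ e ∈ G.edges, ∀ x ∈ e, ∀ y ∈ e, H.adjGraph.Reachable x y) : H.adjGraph.Connected :=
  have := hG.nonempty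
  ⟨fun u v => reachable_of_forall_edge h (hG.preconnected u v)⟩

theorem IsUniform.sum_card_sub_one (hG : G.IsUniform k) :
    ∑ e ∈ G.edges, (e.card - 1) = G.edges.card * (k - 1) := by
  rw [Finset.sum_congr rfl fun e he => by rw [hG e he], Finset.sum_const, smul_eq_mul]

theorem IsSupertree.of_card_edges_le [Finite V] (hG : G.IsSupertree) (hk : 2 ≤ k)
    (hGk : G.IsUniform k) (hH : H.adjGraph.Connected) (hcard : ∀ e ∈ H.edges, e.card ≤ k)
    (hle : H.edges.card ≤ G.edges.card) :
    H.edges.card = G.edges.card ∧ H.IsUniform k ∧ H.IsSupertree := by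
  have := Fintype.ofFinite V
  have hterm : ∀ e ∈ H.edges, e.card - 1 ≤ k - 1 := fun e he =>
    Nat.sub_le_sub_right (hcard e he) 1
  have hsum : ∑ e ∈ H.edges, (e.card - 1) ≤ H.edges.card * (k - 1) := by
    simpa using Finset.sum_le_sum hterm
  have hmul := Nat.mul_le_mul_right (k - 1) hle
  have hGcard := hG.card_eq
  rw [hGk.sum_card_sub_one] at hGcard
  have hHcard := card_le_of_connected hH
  refine ⟨Nat.eq_of_mul_eq_mul_right (by omega) (by omega : H.edges.card * (k - 1) = _),
    fun e he => ?_, isSupertree_of_card_eq hH (by omega)⟩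
  have heq := (Finset.sum_eq_sum_iff_of_le hterm).1
    (by rw [Finset.sum_const, smul_eq_mul]; omega) e he
  have := Finset.card_pos.2 (H.nonempty_of_mem e he)
  omega

theorem IsUniform.sum_sub_le {f : V → ℝ} {e : Finset V} (hG : G.IsUniform k) (he : e ∈ G.edges)
    (hu : u ∈ e) {c : ℝ}
    (h : ∀ x ∈ e, x ≠ u → f x ≤ c) : ∑ x ∈ e, f x - f u ≤ ((k : ℝ) - 1) * c := by
  classical
  have hcard : ((e.erase u).card : ℝ) = (k : ℝ) - 1 := by
    rw [Finset.cast_card_erase_of_mem hu, hG e he]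
  rw [← Finset.sum_erase_eq_sub hu, ← hcard, ← nsmul_eq_mul]
  exact Finset.sum_le_card_nsmul _ _ _ fun x hx =>
    h x (Finset.mem_of_mem_erase hx) (Finset.ne_of_mem_erase hx)

variable [DecidableEq V] {M N : Finset (Finset V)} {e e₁ e₂ : Finset V} {a b g₁ g₂ : V}

/-- The edge `e` with `u` replaced by `v` if `e ∈ M`, and with `v` replaced by `u` if `e ∈ N`. -/
def exchangeEdge (M N : Finset (Finset V)) (u v : V) (e : Finset V) : Finset V :=
  if e ∈ M then insert v (e.erase u) else if e ∈ N then insert u (e.erase v) else e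

/-- The hypergraph obtained from `G` by replacing `u` by `v` in the edges in `M` and `v` by `u` in
the edges in `N`. The competitors of a Faber–Krahn supertree are constructed in this way. -/
def exchange (G : FinHypergraph V) (M N : Finset (Finset V)) (u v : V) : FinHypergraph V where
  edges := G.edges.image (exchangeEdge M N u v)
  nonempty_of_mem := Finset.forall_mem_image.2 fun e he => by
    unfold exchangeEdge
    split_ifs
    exacts [Finset.insert_nonempty _ _, Finset.insert_nonempty _ _, G.nonempty_of_mem e he]

/-- `G.exchange M N u v` is defined by an actual exchange of vertices that keeps `G` connected. -/
structure IsExchange (G : FinHypergraph V) (M N : Finset (Finset V)) (u v : V) : Prop where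
  left_subset : M ⊆ G.edges
  right_subset : N ⊆ G.edges
  disjoint : Disjoint M N
  mem_left : ∀ e ∈ M, u ∈ e
  mem_right : ∀ e ∈ N, v ∈ e
  ne : u ≠ v
  connected : (G.exchange M N u v).adjGraph.Connected

theorem exchangeEdge_of_mem_left (he : e ∈ M) : exchangeEdge M N u v e = insert v (e.erase u) :=
  if_pos he

theorem exchangeEdge_of_mem_right (h : Disjoint M N) (he : e ∈ N) :
    exchangeEdge M N u v e = insert u (e.erase v) := by
  rw [exchangeEdge, if_neg fun heM => Finset.disjoint_left.1 h heM he, if_pos he]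

theorem exchangeEdge_of_notMem (hM : e ∉ M) (hN : e ∉ N) : exchangeEdge M N u v e = e := by
  rw [exchangeEdge, if_neg hM, if_neg hN]

theorem exchangeEdge_mem_edges (he : e ∈ G.edges) :
    exchangeEdge M N u v e ∈ (G.exchange M N u v).edges :=
  Finset.mem_image_of_mem _ he

theorem mem_exchange_edges (he : e ∈ G.edges) (hM : e ∉ M) (hN : e ∉ N) :
    e ∈ (G.exchange M N u v).edges := by
  simpa only [exchangeEdge_of_notMem hM hN] using exchangeEdge_mem_edges (M := M) (N := N) he

theorem insert_erase_mem_exchange_edges_left (he : e ∈ G.edges) (hM : e ∈ M) :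
    insert v (e.erase u) ∈ (G.exchange M N u v).edges := by
  rw [← exchangeEdge_of_mem_left (N := N) hM]
  exact exchangeEdge_mem_edges he

theorem insert_erase_mem_exchange_edges_right (h : Disjoint M N) (he : e ∈ G.edges) (hN : e ∈ N) :
    insert u (e.erase v) ∈ (G.exchange M N u v).edges := by
  rw [← exchangeEdge_of_mem_right h hN]
  exact exchangeEdge_mem_edges he

theorem exchange_swap (h : Disjoint M N) (G : FinHypergraph V) (u v : V) :
    G.exchange N M v u = G.exchange M N u v := by
  have hedge : ∀ e, exchangeEdge N M v u e = exchangeEdge M N u v e := fun e => by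
    unfold exchangeEdge
    split_ifs with hN hM
    exacts [absurd hN (Finset.disjoint_left.1 h hM), rfl, rfl, rfl]
  simp only [exchange, funext hedge]

theorem IsExchange.symm (h : G.IsExchange M N u v) : G.IsExchange N M v u where
  left_subset := h.right_subset
  right_subset := h.left_subset
  disjoint := h.disjoint.symm
  mem_left := h.mem_right
  mem_right := h.mem_left
  ne := h.ne.symm
  connected := exchange_swap h.disjoint G u v ▸ h.connected

theorem isExchange_of_linked (hG : G.adjGraph.Connected) (hM : M ⊆ G.edges) (hN : N ⊆ G.edges)
    (hdisj : Disjoint M N) (hu : ∀ e ∈ M, u ∈ e) (hv : ∀ e ∈ N, v ∈ e) (huv : u ≠ v)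
    (hlink : G.Linked (fun c => c ∉ M ∧ c ∉ N) u v) : G.IsExchange M N u v := by
  refine ⟨hM, hN, hdisj, hu, hv, huv, connected_of_forall_edge hG fun e he x hx y hy => ?_⟩
  have hreach : (G.exchange M N u v).adjGraph.Reachable u v :=
    hlink.reachable fun e he h => mem_exchange_edges he h.1 h.2
  by_cases heM : e ∈ M
  · have hxv : ∀ x ∈ e, (G.exchange M N u v).adjGraph.Reachable x v := fun x hx => by
      by_cases hxu : x = u
      · exact hxu ▸ hreach
      · exact reachable_of_mem_edge (insert_erase_mem_exchange_edges_left he heM)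
          (Finset.mem_insert_of_mem (Finset.mem_erase.2 ⟨hxu, hx⟩)) (Finset.mem_insert_self _ _)
    exact (hxv x hx).trans (hxv y hy).symm
  by_cases heN : e ∈ N
  · have hxu : ∀ x ∈ e, (G.exchange M N u v).adjGraph.Reachable x u := fun x hx => by
      by_cases hxv : x = v
      · exact hxv ▸ hreach.symm
      · exact reachable_of_mem_edge (insert_erase_mem_exchange_edges_right hdisj he heN)
          (Finset.mem_insert_of_mem (Finset.mem_erase.2 ⟨hxv, hx⟩)) (Finset.mem_insert_self _ _)
    exact (hxu x hx).trans (hxu y hy).symm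
  · exact reachable_of_mem_edge (mem_exchange_edges he heM heN) hx hy

theorem isExchange_singleton_of_linked (hG : G.adjGraph.Connected) (he₁ : e₁ ∈ G.edges)
    (he₂ : e₂ ∈ G.edges) (hne : e₁ ≠ e₂) (ha : a ∈ e₁) (hb : b ∈ e₂) (hab : a ≠ b)
    (hlink : G.Linked (fun c => c ≠ e₁ ∧ c ≠ e₂) a b) : G.IsExchange {e₁} {e₂} a b :=
  isExchange_of_linked hG (by simpa) (by simpa) (by simpa using hne) (by simpa) (by simpa) hab
    (by simpa using hlink)

theorem IsSupertree.isExchange_singleton_of_linked_of_ne (hG : G.IsSupertree) (he₁ : e₁ ∈ G.edges)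
    (he₂ : e₂ ∈ G.edges) (hne : e₁ ≠ e₂) (hg₁ : g₁ ∈ e₁) (hg₂ : g₂ ∈ e₂)
    (hlink : G.Linked (fun c => c ≠ e₁ ∧ c ≠ e₂) g₁ g₂) (ha : a ∈ e₁) (hb : b ∈ e₂)
    (hag : a ≠ g₁) (hbg : b ≠ g₂) : G.IsExchange {e₁} {e₂} a b := by
  have hab : a ≠ b := by
    rintro rfl
    refine hG.2 (hasCycle_of_linked_ne he₁ ha hg₁ hag ?_)
    exact (linked_of_mem_edge he₂ hne.symm hb hg₂).trans (hlink.symm.mono fun e _ h => h.1)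
  have hdisj : Disjoint ({e₁} : Finset (Finset V)) {e₂} := by simpa using hne
  refine ⟨by simpa, by simpa, hdisj, by simpa, by simpa, hab, ?_⟩
  set H := G.exchange {e₁} {e₂} a b
  have hgates : H.adjGraph.Reachable g₁ g₂ :=
    hlink.reachable fun e he h => mem_exchange_edges he (by simpa using h.1) (by simpa using h.2)
  have hreach₁ : ∀ x, x = b ∨ (x ≠ a ∧ x ∈ e₁) → H.adjGraph.Reachable x g₁ := fun x hx =>
    reachable_of_mem_edge (insert_erase_mem_exchange_edges_left he₁ (by simp)) (by simpa using hx)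
      (by simp [hag.symm, hg₁])
  have hreach₂ : ∀ x, x = a ∨ (x ≠ b ∧ x ∈ e₂) → H.adjGraph.Reachable x g₁ := fun x hx =>
    (reachable_of_mem_edge (insert_erase_mem_exchange_edges_right hdisj he₂ (by simp))
      (by simpa using hx) (by simp [hbg.symm, hg₂])).trans hgates.symm
  refine connected_of_forall_edge hG.1 fun e he x hx y hy => ?_
  have hreach : e = e₁ ∨ e = e₂ → ∀ x ∈ e, H.adjGraph.Reachable x g₁ := by
    rintro he x hx
    by_cases hxa : x = a
    · exact hreach₂ x (.inl hxa)
    by_cases hxb : x = b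
    · exact hreach₁ x (.inl hxb)
    rcases he with rfl | rfl
    exacts [hreach₁ x (.inr ⟨hxa, hx⟩), hreach₂ x (.inr ⟨hxb, hx⟩)]
  by_cases he' : e = e₁ ∨ e = e₂
  · exact (hreach he' x hx).trans (hreach he' y hy).symm
  · rw [not_or] at he'
    exact reachable_of_mem_edge (mem_exchange_edges he (by simpa using he'.1)
      (by simpa using he'.2)) hx hy

theorem card_insert_erase_le (hu : u ∈ e) : (insert v (e.erase u)).card ≤ e.card :=
  (Finset.card_insert_le _ _).trans (Finset.card_erase_add_one hu).le

theorem notMem_of_card_insert_erase (hu : u ∈ e) (huv : u ≠ v)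
    (h : (insert v (e.erase u)).card = e.card) : v ∉ e := by
  intro hv
  rw [Finset.insert_eq_of_mem (Finset.mem_erase.2 ⟨huv.symm, hv⟩)] at h
  exact (Finset.card_erase_lt_of_mem hu).ne h

theorem sum_insert_erase {A : Type*} [AddCommGroup A] (hu : u ∈ e) (hv : v ∉ e) (F : V → A) :
    ∑ x ∈ insert v (e.erase u), F x = ∑ x ∈ e, F x - F u + F v := by
  rw [Finset.sum_insert fun h => hv (Finset.mem_of_mem_erase h), Finset.sum_erase_eq_sub hu,
    add_comm]

theorem edgeEnergy_insert_erase (hu : u ∈ e) (hv : v ∉ e) (k : ℕ) (f : V → ℝ) :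
    edgeEnergy k f (insert v (e.erase u)) = edgeEnergy k f e +
      (f v - f u) * (((k : ℝ) - 1) * (f u + f v) - 2 * (∑ x ∈ e, f x - f u)) := by
  simp only [edgeEnergy, sum_insert_erase hu hv]
  ring

namespace IsExchange

variable [Finite V]

theorem card_edges_eq_and_isUniform_and_isSupertree (h : G.IsExchange M N u v) (hk : 2 ≤ k)
    (hGk : G.IsUniform k) (hG : G.IsSupertree) :
    (G.exchange M N u v).edges.card = G.edges.card ∧ (G.exchange M N u v).IsUniform k ∧
      (G.exchange M N u v).IsSupertree := by
  refine hG.of_card_edges_le hk hGk h.connected ?_ Finset.card_image_le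
  refine Finset.forall_mem_image.2 fun e he => ?_
  rw [← hGk e he]
  unfold exchangeEdge
  split_ifs with heM heN
  exacts [card_insert_erase_le (h.mem_left e heM), card_insert_erase_le (h.mem_right e heN), le_rfl]

theorem notMem_left (h : G.IsExchange M N u v) (hk : 2 ≤ k) (hGk : G.IsUniform k)
    (hG : G.IsSupertree) (he : e ∈ M) : v ∉ e := by
  refine notMem_of_card_insert_erase (h.mem_left e he) h.ne ?_
  rw [hGk e (h.left_subset he)]
  exact (h.card_edges_eq_and_isUniform_and_isSupertree hk hGk hG).2.1 _
    (insert_erase_mem_exchange_edges_left (h.left_subset he) he)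

theorem notMem_right (h : G.IsExchange M N u v) (hk : 2 ≤ k) (hGk : G.IsUniform k)
    (hG : G.IsSupertree) (he : e ∈ N) : u ∉ e :=
  h.symm.notMem_left hk hGk hG he

theorem sum_exchange_edges {A : Type*} [AddCommGroup A] (h : G.IsExchange M N u v) (hk : 2 ≤ k)
    (hGk : G.IsUniform k) (hG : G.IsSupertree) (F : Finset V → A) :
    ∑ e ∈ (G.exchange M N u v).edges, F e = ∑ e ∈ G.edges, F e +
      ∑ e ∈ M, (F (insert v (e.erase u)) - F e) + ∑ e ∈ N, (F (insert u (e.erase v)) - F e) := by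
  have hinj : Set.InjOn (exchangeEdge M N u v) G.edges := Finset.card_image_iff.1
    (h.card_edges_eq_and_isUniform_and_isSupertree hk hGk hG).1
  have hterm : ∀ e, F (exchangeEdge M N u v e) = F e +
      (if e ∈ M then F (insert v (e.erase u)) - F e else 0) +
      if e ∈ N then F (insert u (e.erase v)) - F e else 0 := by
    intro e
    by_cases heM : e ∈ M
    · simp [exchangeEdge_of_mem_left heM, heM, Finset.disjoint_left.1 h.disjoint heM]
    by_cases heN : e ∈ N
    · simp [exchangeEdge_of_mem_right h.disjoint heN, heM, heN]
    · simp [exchangeEdge_of_notMem heM heN, heM, heN]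
  rw [exchange, Finset.sum_image hinj]
  simp only [hterm, Finset.sum_add_distrib, Finset.sum_ite_mem,
    Finset.inter_eq_right.2 h.left_subset, Finset.inter_eq_right.2 h.right_subset]

theorem degree_left (h : G.IsExchange M N u v) (hk : 2 ≤ k) (hGk : G.IsUniform k)
    (hG : G.IsSupertree) : (G.exchange M N u v).degree u + M.card = G.degree u + N.card := by
  have hM : ∀ e ∈ M, ((if u ∈ insert v (e.erase u) then 1 else 0) - if u ∈ e then 1 else 0) =
      (-1 : ℤ) := fun e he => by simp [h.mem_left e he, h.ne]
  have hN : ∀ e ∈ N, ((if u ∈ insert u (e.erase v) then 1 else 0) - if u ∈ e then 1 else 0) =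
      (1 : ℤ) := fun e he => by simp [h.notMem_right hk hGk hG he]
  zify
  simp only [degree, Finset.natCast_card_filter, h.sum_exchange_edges hk hGk hG]
  rw [Finset.sum_congr rfl hM, Finset.sum_congr rfl hN, Finset.sum_const, Finset.sum_const,
    nsmul_eq_mul, nsmul_eq_mul]
  ring

theorem degree_right (h : G.IsExchange M N u v) (hk : 2 ≤ k) (hGk : G.IsUniform k)
    (hG : G.IsSupertree) : (G.exchange M N u v).degree v + N.card = G.degree v + M.card :=
  exchange_swap h.disjoint G u v ▸ h.symm.degree_left hk hGk hG

theorem degree_of_ne (h : G.IsExchange M N u v) (hk : 2 ≤ k) (hGk : G.IsUniform k)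
    (hG : G.IsSupertree) {w : V} (hu : w ≠ u) (hv : w ≠ v) :
    (G.exchange M N u v).degree w = G.degree w := by
  zify
  simp only [degree, Finset.natCast_card_filter, h.sum_exchange_edges hk hGk hG]
  simp [hu, hv]

theorem energy_exchange (h : G.IsExchange M N u v) (hk : 2 ≤ k) (hGk : G.IsUniform k)
    (hG : G.IsSupertree) (f : V → ℝ) :
    (G.exchange M N u v).energy k f = G.energy k f + (f v - f u) *
      (∑ e ∈ M, (((k : ℝ) - 1) * (f u + f v) - 2 * (∑ x ∈ e, f x - f u)) -
        ∑ e ∈ N, (((k : ℝ) - 1) * (f u + f v) - 2 * (∑ x ∈ e, f x - f v))) := by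
  have hM : ∀ e ∈ M, edgeEnergy k f (insert v (e.erase u)) - edgeEnergy k f e =
      (f v - f u) * (((k : ℝ) - 1) * (f u + f v) - 2 * (∑ x ∈ e, f x - f u)) := fun e he => by
    rw [edgeEnergy_insert_erase (h.mem_left e he) (h.notMem_left hk hGk hG he),
      add_sub_cancel_left]
  have hN : ∀ e ∈ N, edgeEnergy k f (insert u (e.erase v)) - edgeEnergy k f e =
      -(f v - f u) * (((k : ℝ) - 1) * (f u + f v) - 2 * (∑ x ∈ e, f x - f v)) := fun e he => by
    rw [edgeEnergy_insert_erase (h.mem_right e he) (h.notMem_right hk hGk hG he)]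
    ring
  rw [energy, h.sum_exchange_edges hk hGk hG, Finset.sum_congr rfl hM, Finset.sum_congr rfl hN,
    ← Finset.mul_sum, ← Finset.mul_sum, ← energy]
  ring

theorem lapSum_exchange_left (h : G.IsExchange M N u v) (hk : 2 ≤ k) (hGk : G.IsUniform k)
    (hG : G.IsSupertree) (f : V → ℝ) :
    (G.exchange M N u v).lapSum k f u = G.lapSum k f u -
      ∑ e ∈ M, (k * f u - ∑ x ∈ e, f x) +
        ∑ e ∈ N, (k * f u - (∑ x ∈ e, f x - f v + f u)) := by
  have hM : ∀ e ∈ M, ((if u ∈ insert v (e.erase u) then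
      k * f u - ∑ x ∈ insert v (e.erase u), f x else 0) -
      if u ∈ e then k * f u - ∑ x ∈ e, f x else 0) = -(k * f u - ∑ x ∈ e, f x) := fun e he => by
    simp [h.mem_left e he, h.ne]
  have hN : ∀ e ∈ N, ((if u ∈ insert u (e.erase v) then
      k * f u - ∑ x ∈ insert u (e.erase v), f x else 0) -
      if u ∈ e then k * f u - ∑ x ∈ e, f x else 0) =
        k * f u - (∑ x ∈ e, f x - f v + f u) := fun e he => by
    have hue := h.notMem_right hk hGk hG he
    rw [if_pos (Finset.mem_insert_self _ _), if_neg hue,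
      sum_insert_erase (h.mem_right e he) hue, sub_zero]
  simp only [lapSum_eq_sum_ite]
  rw [h.sum_exchange_edges hk hGk hG, Finset.sum_congr rfl hM, Finset.sum_congr rfl hN,
    Finset.sum_neg_distrib, ← sub_eq_add_neg]

theorem degree_eq_degree_swap (h : G.IsExchange M ∅ u v) (hk : 2 ≤ k)
    (hGk : G.IsUniform k) (hG : G.IsSupertree) (hdeg : G.degree u = G.degree v + M.card) (w : V) :
    (G.exchange M ∅ u v).degree w = G.degree (Equiv.swap u v w) := by
  have hu := h.degree_left hk hGk hG
  have hv := h.degree_right hk hGk hG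
  rw [Finset.card_empty, add_zero] at hu hv
  by_cases hwu : w = u
  · rw [hwu, Equiv.swap_apply_left]
    omega
  by_cases hwv : w = v
  · rw [hwv, Equiv.swap_apply_right]
    omega
  · rw [Equiv.swap_apply_of_ne_of_ne hwu hwv, h.degree_of_ne hk hGk hG hwu hwv]

theorem memClass {V : Type u} [Fintype V] [DecidableEq V] {G : FinHypergraph V}
    {M N : Finset (Finset V)} {u v : V} (h : G.IsExchange M N u v) (hk : 2 ≤ k) {π : Multiset ℕ}
    (hG : G.MemClass k π) (σ : Equiv.Perm V)
    (hσ : ∀ w, (G.exchange M N u v).degree w = G.degree (σ w)) :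
    (G.exchange M N u v).MemClass k π := by
  obtain ⟨-, hunif, htree⟩ :=
    h.card_edges_eq_and_isUniform_and_isSupertree hk hG.isUniform hG.isSupertree
  have hdeg : (G.exchange M N u v).degree = G.degree ∘ σ := funext hσ
  refine ⟨hunif, htree, ?_⟩
  rw [← hG.degreeSequence_eq, degreeSequence, degreeSequence, hdeg, ← Multiset.map_map,
    Multiset.map_univ_val_equiv]

end IsExchange

end Exchange

/-! ### Exchanges in Faber–Krahn supertrees -/

section FaberKrahn

variable {V : Type u} [Fintype V] [DecidableEq V] {G H : FinHypergraph V} {k : ℕ}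
  {π : Multiset ℕ} {f : V → ℝ} {M : Finset (Finset V)} {e e₁ e₂ : Finset V} {a b u v : V}

/-- By minimality of the eigenvalue, a ground state of `G` whose energy does not increase is also
a minimizer on `H`, for the same eigenvalue. -/
theorem IsGroundState.energy_eq_and_lapSum_eq_of_energy_le (hk : 2 ≤ k)
    (hFK : G.HasFaberKrahn k π) (hf : G.IsGroundState k f) (hH : H.MemClass k π)
    (hbd : ∀ v, H.IsBoundary v ↔ G.IsBoundary v) (hv : ¬ G.IsBoundary v)
    (hle : H.energy k f ≤ G.energy k f) :
    H.energy k f = G.energy k f ∧ H.lapSum k f v = G.lapSum k f v := by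
  have hvH : ¬ H.IsBoundary v := fun h => hv ((hbd v).1 h)
  have hvanish : H.VanishesOnBoundary f := fun v hv => hf.vanishes v ((hbd v).1 hv)
  have hpos : 0 < ∑ v, f v ^ 2 := Finset.sum_pos' (fun i _ => sq_nonneg (f i))
    ⟨v, Finset.mem_univ v, pow_pos (hf.pos v hv) 2⟩
  have hk' : (1 : ℝ) ≤ k := by exact_mod_cast one_le_two.trans hk
  have hscaled : G.scaledEigenvalue k ≤ H.scaledEigenvalue k :=
    mul_le_mul_of_nonneg_left (hFK.2 V H hH) (sub_nonneg.2 hk')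
  have hmin : H.scaledEigenvalue k * ∑ v, f v ^ 2 ≤ H.energy k f :=
    scaledEigenvalue_mul_le hk hH.isUniform ⟨v, hvH⟩ hvanish
  have hmono := mul_le_mul_of_nonneg_right hscaled hpos.le
  have hG := hf.energy_eq
  have heq : H.scaledEigenvalue k = G.scaledEigenvalue k :=
    mul_right_cancel₀ hpos.ne' (le_antisymm (by linarith) hmono)
  refine ⟨by linarith, ?_⟩
  rw [hf.lapSum_eq v hv, ← heq]
  exact lapSum_eq_of_energy_le
    (fun g hg => scaledEigenvalue_mul_le hk hH.isUniform ⟨v, hvH⟩ hg) hvanish (by linarith) hvH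

theorem IsExchange.energy_eq_and_lapSum_eq (h : G.IsExchange {e₁} {e₂} a b) (hk : 2 ≤ k)
    (hFK : G.HasFaberKrahn k π) (hf : G.IsGroundState k f) (hv : ¬ G.IsBoundary v)
    (hle : (G.exchange {e₁} {e₂} a b).energy k f ≤ G.energy k f) :
    (G.exchange {e₁} {e₂} a b).energy k f = G.energy k f ∧
      (G.exchange {e₁} {e₂} a b).lapSum k f v = G.lapSum k f v := by
  obtain ⟨hunif, htree, -⟩ := hFK.1
  have hdeg : ∀ w, (G.exchange {e₁} {e₂} a b).degree w = G.degree w := by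
    intro w
    by_cases hwa : w = a
    · simpa [hwa] using h.degree_left hk hunif htree
    by_cases hwb : w = b
    · simpa [hwb] using h.degree_right hk hunif htree
    · exact h.degree_of_ne hk hunif htree hwa hwb
  exact hf.energy_eq_and_lapSum_eq_of_energy_le hk hFK (h.memClass hk hFK.1 1 hdeg)
    (fun w => by rw [IsBoundary, IsBoundary, hdeg]) hv hle

theorem IsExchange.sum_lt_sum (h : G.IsExchange {e₁} {e₂} a b) (hk : 2 ≤ k)
    (hFK : G.HasFaberKrahn k π) (hf : G.IsGroundState k f) (hab : f a < f b) :
    ∑ x ∈ e₁, f x < ∑ x ∈ e₂, f x := by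
  by_contra! hge
  have hb : ¬ G.IsBoundary b := hf.not_isBoundary ((hf.nonneg a).trans_lt hab)
  have henergy := h.energy_exchange hk hFK.1.isUniform hFK.1.isSupertree f
  rw [Finset.sum_singleton, Finset.sum_singleton] at henergy
  have hdecrease : 0 < (f b - f a) * ((∑ x ∈ e₁, f x - f a) - (∑ x ∈ e₂, f x - f b)) := by
    apply mul_pos <;> linarith
  have heq := (h.energy_eq_and_lapSum_eq hk hFK hf hb (by linarith)).1
  linarith

theorem IsExchange.sum_eq_sum (h : G.IsExchange {e₁} {e₂} a b) (hk : 2 ≤ k)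
    (hFK : G.HasFaberKrahn k π) (hf : G.IsGroundState k f) (hab : f a = f b) (ha : 0 < f a) :
    ∑ x ∈ e₁, f x = ∑ x ∈ e₂, f x := by
  have henergy := h.energy_exchange hk hFK.1.isUniform hFK.1.isSupertree f
  rw [hab, sub_self, zero_mul, add_zero] at henergy
  have hlap := (h.energy_eq_and_lapSum_eq hk hFK hf (hf.not_isBoundary ha) henergy.le).2
  rw [h.lapSum_exchange_left hk hFK.1.isUniform hFK.1.isSupertree, Finset.sum_singleton,
    Finset.sum_singleton] at hlap
  linarith

theorem IsExchange.energy_eq_and_lapSum_eq_of_degree_eq (h : G.IsExchange M ∅ u v) (hk : 2 ≤ k)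
    (hFK : G.HasFaberKrahn k π) (hf : G.IsGroundState k f) (hu : ¬ G.IsBoundary u)
    (hv : ¬ G.IsBoundary v) (hdeg : G.degree u = G.degree v + M.card)
    (hle : (G.exchange M ∅ u v).energy k f ≤ G.energy k f) :
    (G.exchange M ∅ u v).energy k f = G.energy k f ∧
      (G.exchange M ∅ u v).lapSum k f u = G.lapSum k f u := by
  have hswap := h.degree_eq_degree_swap hk hFK.1.isUniform hFK.1.isSupertree hdeg
  refine hf.energy_eq_and_lapSum_eq_of_energy_le hk hFK (h.memClass hk hFK.1 _ hswap)
    (fun w => ?_) hu hle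
  rw [IsBoundary, hswap]
  by_cases hwu : w = u
  · rw [hwu, Equiv.swap_apply_left]
    exact iff_of_false hv hu
  by_cases hwv : w = v
  · rw [hwv, Equiv.swap_apply_right]
    exact iff_of_false hu hv
  · rw [Equiv.swap_apply_of_ne_of_ne hwu hwv, IsBoundary]

/-- Two interior vertices of different degrees could otherwise exchange their degrees by moving
`M` from `u` to `v`, at no cost in energy. -/
theorem IsExchange.mul_le_sum (h : G.IsExchange M ∅ u v) (hk : 2 ≤ k)
    (hFK : G.HasFaberKrahn k π) (hf : G.IsGroundState k f) (hu : ¬ G.IsBoundary u)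
    (hv : ¬ G.IsBoundary v) (hdeg : G.degree u = G.degree v + M.card) (hvu : f v ≤ f u)
    (hle : ∀ e ∈ M, ∀ x ∈ e, x ≠ u → f x ≤ f v) (he : e ∈ M) : k * f u ≤ ∑ x ∈ e, f x := by
  obtain ⟨hunif, htree, -⟩ := hFK.1
  have hk' : (0 : ℝ) < (k : ℝ) - 1 := sub_pos.2 (by exact_mod_cast hk)
  have hsum : ∀ e ∈ M, ∑ x ∈ e, f x - f u ≤ ((k : ℝ) - 1) * f v := fun e he =>
    hunif.sum_sub_le (h.left_subset he) (h.mem_left e he) (hle e he)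
  have hlower : M.card * (((k : ℝ) - 1) * (f u - f v)) ≤
      ∑ e ∈ M, (((k : ℝ) - 1) * (f u + f v) - 2 * (∑ x ∈ e, f x - f u)) := by
    rw [← nsmul_eq_mul]
    exact Finset.card_nsmul_le_sum _ _ _ fun e he => by linarith [hsum e he]
  have henergy := h.energy_exchange hk hunif htree f
  rw [Finset.sum_empty, sub_zero] at henergy
  have hdecrease := mul_le_mul_of_nonneg_left hlower (sub_nonneg.2 hvu)
  have hsq : 0 ≤ M.card * ((k : ℝ) - 1) * (f u - f v) ^ 2 := by positivity
  obtain ⟨heq, hlap⟩ :=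
    h.energy_eq_and_lapSum_eq_of_degree_eq hk hFK hf hu hv hdeg (by nlinarith)
  have hM : (0 : ℝ) < M.card := Nat.cast_pos.2 (Finset.card_pos.2 ⟨e, he⟩)
  have hfuv : f u = f v := by
    have hzero : M.card * ((k : ℝ) - 1) * (f u - f v) ^ 2 = 0 := le_antisymm (by nlinarith) hsq
    exact sub_eq_zero.1 (pow_eq_zero_iff two_ne_zero |>.1
      ((mul_eq_zero.1 hzero).resolve_left (mul_pos hM hk').ne'))
  rw [h.lapSum_exchange_left hk hunif htree, Finset.sum_empty, add_zero, sub_eq_self] at hlap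
  have hterm := (Finset.sum_eq_zero_iff_of_nonneg
    fun e he => by rw [hfuv]; linarith [hsum e he, hfuv]).1 hlap e he
  linarith

end FaberKrahn

end FinHypergraph

namespace FinHypergraph

/-! ### Monotonicity of the ground state -/

section Extremal

variable {V : Type u} [Fintype V] [DecidableEq V]

/-- `f` is a ground state of the Faber–Krahn supertree `G`, not all of whose vertices lie on the
boundary, and attains its maximum at `root`. -/
structure IsExtremal (G : FinHypergraph V) (k : ℕ) (π : Multiset ℕ) (f : V → ℝ) (root : V) :
    Prop where
  two_le : 2 ≤ k
  faberKrahn : G.HasFaberKrahn k π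
  groundState : G.IsGroundState k f
  exists_interior : ∃ v, ¬ G.IsBoundary v
  le_root : ∀ v, f v ≤ f root

end Extremal

section Edges

variable {V : Type u} {G : FinHypergraph V} {k : ℕ} {root y : V} {e : Finset V}

theorem IsUniform.exists_mem_ne (hG : G.IsUniform k) (hk : 2 ≤ k) (he : e ∈ G.edges) (t : V) :
    ∃ y ∈ e, y ≠ t :=
  Finset.exists_mem_ne (by rw [hG e he]; omega) t

theorem exists_edge_ne [DecidableEq V] (hy : ¬ G.IsBoundary y) (he : e ∈ G.edges) (hye : y ∈ e) :
    ∃ e' ∈ G.edges, y ∈ e' ∧ e' ≠ e := by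
  have hpos : 0 < G.degree y := Finset.card_pos.2 ⟨e, Finset.mem_filter.2 ⟨he, hye⟩⟩
  have hone : 1 < G.degree y := lt_of_le_of_ne hpos (Ne.symm hy)
  obtain ⟨e', he', hne⟩ := Finset.exists_mem_ne hone e
  exact ⟨e', (Finset.mem_filter.1 he').1, (Finset.mem_filter.1 he').2, hne⟩

theorem IsSupertree.exists_apex_eq [DecidableEq V] (hG : G.IsSupertree) (hy : ¬ G.IsBoundary y)
    (he : e ∈ G.edges) (hye : y ∈ e) (hya : y ≠ G.apex root e) :
    ∃ e' ∈ G.edges, G.apex root e' = y := by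
  obtain ⟨e', he', hye', hne⟩ := exists_edge_ne hy he hye
  refine ⟨e', he', ?_⟩
  by_contra h
  exact hne (hG.edge_eq he he' hye hye' hya (Ne.symm h))

end Edges

namespace IsExtremal

variable {V : Type u} [Fintype V] [DecidableEq V] {G : FinHypergraph V} {k : ℕ} {π : Multiset ℕ}
  {f : V → ℝ} {root a b q u v x y : V} {e e₁ e₂ : Finset V}

theorem isUniform (h : G.IsExtremal k π f root) : G.IsUniform k :=
  h.faberKrahn.1.isUniform

theorem isSupertree (h : G.IsExtremal k π f root) : G.IsSupertree :=
  h.faberKrahn.1.isSupertree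

theorem connected (h : G.IsExtremal k π f root) : G.adjGraph.Connected :=
  h.isSupertree.1

theorem sum_lt_sum (h : G.IsExtremal k π f root) (hex : G.IsExchange {e₁} {e₂} a b)
    (hab : f a < f b) : ∑ x ∈ e₁, f x < ∑ x ∈ e₂, f x :=
  hex.sum_lt_sum h.two_le h.faberKrahn h.groundState hab

theorem sum_eq_sum (h : G.IsExtremal k π f root) (hex : G.IsExchange {e₁} {e₂} a b)
    (hab : f a = f b) (ha : 0 < f a) : ∑ x ∈ e₁, f x = ∑ x ∈ e₂, f x :=
  hex.sum_eq_sum h.two_le h.faberKrahn h.groundState hab ha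

theorem root_pos (h : G.IsExtremal k π f root) : 0 < f root := by
  obtain ⟨v, hv⟩ := h.exists_interior
  exact (h.groundState.pos v hv).trans_le (h.le_root v)

theorem apex_pos (h : G.IsExtremal k π f root) (he : e ∈ G.edges) : 0 < f (G.apex root e) := by
  by_cases hr : G.apex root e = root
  · rw [hr]
    exact h.root_pos
  · refine h.groundState.pos _ fun hb => ne_parent h.connected hr ?_
    rw [parent, hb.edge_eq (parentEdge_mem_edges h.connected hr) he
      (mem_parentEdge h.connected hr) (apex_mem he)]

theorem apex_lt_of_sum_lt (h : G.IsExtremal k π f root) (he₁ : e₁ ∈ G.edges)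
    (he₂ : e₂ ∈ G.edges) (hq : q ∈ e₁) (hqe : q ≠ G.apex root e₁)
    (hdesc : G.IsDescendant root (G.apex root e₂) q) (hsum : ∑ x ∈ e₁, f x < ∑ x ∈ e₂, f x)
    (hy : y ∈ e₂) (hye : y ≠ G.apex root e₂) : f (G.apex root e₁) < f y := by
  obtain ⟨hne, hlink⟩ := hdesc.ne_and_linked_ne h.isSupertree he₁ hq hqe
  have hex : G.IsExchange {e₂} {e₁} y (G.apex root e₁) :=
    h.isSupertree.isExchange_singleton_of_linked_of_ne he₂ he₁ hne (apex_mem he₂) hq hlink hy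
      (apex_mem he₁) hye hqe.symm
  by_contra! hle
  rcases hle.lt_or_eq with hlt | heq
  · exact hsum.not_gt (h.sum_lt_sum hex hlt)
  · exact hsum.ne' (h.sum_eq_sum hex heq (heq ▸ h.apex_pos he₁))

theorem sum_parentEdge_lt_sum (h : G.IsExtremal k π f root) (hx : x ≠ root) (he : e ∈ G.edges)
    (hdesc : G.IsDescendant root (G.apex root e) x) (hlt : f x < f (G.apex root e)) :
    ∑ y ∈ G.parentEdge root x, f y < ∑ y ∈ e, f y := by
  have hpar := parentEdge_mem_edges h.connected hx
  have hmem := mem_parentEdge h.connected hx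
  obtain ⟨hne, hlink⟩ :=
    hdesc.ne_and_linked_ne h.isSupertree hpar hmem (ne_parent h.connected hx)
  refine h.sum_lt_sum (a := x) (b := G.apex root e) ?_ hlt
  exact (isExchange_singleton_of_linked h.connected he hpar hne (apex_mem he) hmem
    (ne_of_apply_ne f hlt.ne') hlink).symm

/-- A heavier edge `e₂` below `e₁` would make the apex of `e₁` smaller than a vertex below it; the
same then happens at the parent edge of this apex, and so on up to the root. -/
theorem sum_le_sum_of_isDescendant (h : G.IsExtremal k π f root) (he₁ : e₁ ∈ G.edges)
    (he₂ : e₂ ∈ G.edges) (hq : q ∈ e₁) (hqe : q ≠ G.apex root e₁)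
    (hdesc : G.IsDescendant root (G.apex root e₂) q) : ∑ x ∈ e₂, f x ≤ ∑ x ∈ e₁, f x := by
  induction hn : G.height root (G.apex root e₁) using Nat.strong_induction_on
    generalizing e₁ e₂ q with
  | _ n ih =>
    by_contra! hsum
    obtain ⟨y, hy, hye⟩ := h.isUniform.exists_mem_ne h.two_le he₂ (G.apex root e₂)
    have hlt := h.apex_lt_of_sum_lt he₁ he₂ hq hqe hdesc hsum hy hye
    have hr : G.apex root e₁ ≠ root := fun hr => (hr ▸ hlt).not_ge (h.le_root y)
    have hyb := h.groundState.not_isBoundary ((h.apex_pos he₁).trans hlt)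
    obtain ⟨e, he, rfl⟩ := h.isSupertree.exists_apex_eq hyb he₂ hy hye
    have hdesc' : G.IsDescendant root (G.apex root e) (G.apex root e₁) :=
      ((h.isSupertree.isDescendant_apex he₂ hy).trans hdesc).trans
        (h.isSupertree.isDescendant_apex he₁ hq)
    refine (h.sum_parentEdge_lt_sum hr he hdesc' hlt).not_ge ?_
    exact ih _ (hn ▸ (parentEdge_spec h.connected hr).2.2) (parentEdge_mem_edges h.connected hr) he
      (mem_parentEdge h.connected hr) (ne_parent h.connected hr) hdesc' rfl

theorem le_apex (h : G.IsExtremal k π f root) (he : e ∈ G.edges) (hy : y ∈ e) :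
    f y ≤ f (G.apex root e) := by
  by_contra! hlt
  have hr : G.apex root e ≠ root := fun hr => (hr ▸ hlt).not_ge (h.le_root y)
  have hyb := h.groundState.not_isBoundary ((h.apex_pos he).trans hlt)
  obtain ⟨e', he', rfl⟩ :=
    h.isSupertree.exists_apex_eq hyb he hy (ne_of_apply_ne f hlt.ne')
  have hdesc := h.isSupertree.isDescendant_apex (root := root) he hy
  exact (h.sum_parentEdge_lt_sum hr he' hdesc hlt).not_ge
    (h.sum_le_sum_of_isDescendant (parentEdge_mem_edges h.connected hr) he'
      (mem_parentEdge h.connected hr) (ne_parent h.connected hr) hdesc)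

theorem le_parent (h : G.IsExtremal k π f root) (hv : v ≠ root) : f v ≤ f (G.parent root v) :=
  h.le_apex (parentEdge_mem_edges h.connected hv) (mem_parentEdge h.connected hv)

theorem le_of_isDescendant (h : G.IsExtremal k π f root) (hdesc : G.IsDescendant root v q) :
    f v ≤ f q := by
  induction hdesc with
  | refl => exact le_rfl
  | tail _ hpar ih =>
    obtain ⟨hne, rfl⟩ := h.isSupertree.isParent_iff.1 hpar
    exact ih.trans (h.le_parent hne)

theorem le_of_sum_le (h : G.IsExtremal k π f root) (he₁ : e₁ ∈ G.edges) (he₂ : e₂ ∈ G.edges)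
    (hne : e₁ ≠ e₂)
    (hlink : G.Linked (fun c => c ≠ e₁ ∧ c ≠ e₂) (G.apex root e₁) (G.apex root e₂))
    (hsum : ∑ x ∈ e₂, f x ≤ ∑ x ∈ e₁, f x) (hx : x ∈ e₁) (hxe : x ≠ G.apex root e₁) (hy : y ∈ e₂)
    (hye : y ≠ G.apex root e₂) : f y ≤ f x := by
  by_contra! hlt
  exact hsum.not_gt (h.sum_lt_sum (h.isSupertree.isExchange_singleton_of_linked_of_ne he₁ he₂ hne
    (apex_mem he₁) (apex_mem he₂) hlink hx hy hxe hye) hlt)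

theorem sum_le_of_apex_le (h : G.IsExtremal k π f root) (he₁ : e₁ ∈ G.edges)
    (he₂ : e₂ ∈ G.edges) (hne : G.apex root e₁ ≠ G.apex root e₂)
    (hlink : G.Linked (fun c => c ≠ e₁ ∧ c ≠ e₂) (G.apex root e₁) (G.apex root e₂))
    (hle : f (G.apex root e₂) ≤ f (G.apex root e₁)) : ∑ x ∈ e₂, f x ≤ ∑ x ∈ e₁, f x := by
  have hex := (isExchange_singleton_of_linked h.connected he₁ he₂ (ne_of_apply_ne _ hne)
    (apex_mem he₁) (apex_mem he₂) hne hlink).symm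
  rcases hle.lt_or_eq with hlt | heq
  · exact (h.sum_lt_sum hex hlt).le
  · exact (h.sum_eq_sum hex heq (h.apex_pos he₂)).le

theorem le_of_parent_le_of_linked (h : G.IsExtremal k π f root) (hu : u ≠ root) (hv : v ≠ root)
    (hlink : G.Linked (fun c => c ≠ G.parentEdge root v ∧ c ≠ G.parentEdge root u)
      (G.parent root v) (G.parent root u))
    (hne : G.parent root u ≠ G.parent root v)
    (hle : f (G.parent root v) ≤ f (G.parent root u)) : f v ≤ f u := by
  have hu' := parentEdge_mem_edges h.connected hu
  have hv' := parentEdge_mem_edges h.connected hv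
  have hlink' := hlink.symm.mono fun _ _ hc => hc.symm
  exact h.le_of_sum_le hu' hv' (ne_of_apply_ne _ hne) hlink'
    (h.sum_le_of_apex_le hu' hv' hne hlink' hle) (mem_parentEdge h.connected hu)
    (ne_parent h.connected hu) (mem_parentEdge h.connected hv) (ne_parent h.connected hv)

theorem le_of_parent_isDescendant (h : G.IsExtremal k π f root) (hu : u ≠ root) (hv : v ≠ root)
    (hq : q ∈ G.parentEdge root u) (hqu : q ≠ G.parent root u)
    (hdesc : G.IsDescendant root (G.parent root v) q) : f v ≤ f u := by
  by_cases huq : u = q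
  · exact huq ▸ (h.le_parent hv).trans (h.le_of_isDescendant hdesc)
  have hu' := parentEdge_mem_edges h.connected hu
  have hv' := parentEdge_mem_edges h.connected hv
  obtain ⟨hne, hlink⟩ := hdesc.ne_and_linked_ne h.isSupertree hu' hq hqu
  by_contra! hlt
  have hex := h.isSupertree.isExchange_singleton_of_linked_of_ne hv' hu' hne (apex_mem hv') hq
    hlink (mem_parentEdge h.connected hv) (mem_parentEdge h.connected hu)
    (ne_parent h.connected hv) huq
  exact (h.sum_lt_sum hex.symm hlt).not_ge (h.sum_le_sum_of_isDescendant hu' hv' hq hqu hdesc)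

theorem le_of_parent_le (h : G.IsExtremal k π f root) (hu : u ≠ root) (hv : v ≠ root)
    (huv : G.height root u ≤ G.height root v) (hne : G.parent root u ≠ G.parent root v)
    (hle : f (G.parent root v) ≤ f (G.parent root u)) : f v ≤ f u := by
  have hhu := height_eq_height_parent_add_one h.connected hu
  have hhv := height_eq_height_parent_add_one h.connected hv
  have hheight : G.height root (G.parent root u) ≤ G.height root (G.parent root v) := by omega
  rcases h.isSupertree.isDescendant_or_linked_apex hheight with ⟨q, hq, hqu, hdesc⟩ | hlink
  · exact h.le_of_parent_isDescendant hu hv hq hqu hdesc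
  · exact h.le_of_parent_le_of_linked hu hv hlink hne hle

theorem le_of_height_eq_add_one (h : G.IsExtremal k π f root)
    (huv : G.height root v = G.height root u + 1) : f v ≤ f u := by
  induction hn : G.height root u using Nat.strong_induction_on generalizing u v with
  | _ n ih =>
    by_cases hu : u = root
    · exact hu ▸ h.le_root v
    have hv : v ≠ root := by
      rintro rfl
      simp at huv
    have hhu := height_eq_height_parent_add_one h.connected hu
    have hhv := height_eq_height_parent_add_one h.connected hv
    have hpar : f (G.parent root v) ≤ f (G.parent root u) :=
      ih (G.height root (G.parent root u)) (by omega) (by omega) rfl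
    have hne : G.parent root u ≠ G.parent root v := fun heq => by
      rw [heq] at hhu
      omega
    exact h.le_of_parent_le hu hv (by omega) hne hpar

theorem le_of_height_lt (h : G.IsExtremal k π f root)
    (huv : G.height root u < G.height root v) : f v ≤ f u := by
  induction hn : G.height root v using Nat.strong_induction_on generalizing v with
  | _ n ih =>
    rcases Nat.lt_or_ge (G.height root u + 1) (G.height root v) with hlt | hge
    · have hv : v ≠ root := by
        rintro rfl
        simp at huv
      have hhv := height_eq_height_parent_add_one h.connected hv
      exact (h.le_parent hv).trans (ih _ (by omega) (by omega) rfl)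
    · exact h.le_of_height_eq_add_one (by omega)

theorem le_of_sum_parentEdge_le (h : G.IsExtremal k π f root) (hu : u ≠ root) (hv : v ≠ root)
    (hne : G.parentEdge root u ≠ G.parentEdge root v) (heq : G.parent root u = G.parent root v)
    (hsum : ∑ x ∈ G.parentEdge root v, f x ≤ ∑ x ∈ G.parentEdge root u, f x) : f v ≤ f u := by
  refine h.le_of_sum_le (parentEdge_mem_edges h.connected hu) (parentEdge_mem_edges h.connected hv)
    hne ?_ hsum (mem_parentEdge h.connected hu) (ne_parent h.connected hu)
    (mem_parentEdge h.connected hv) (ne_parent h.connected hv)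
  exact (show G.apex root (G.parentEdge root u) = _ from heq) ▸ .refl _

end IsExtremal

end FinHypergraph

namespace FinHypergraph

/-! ### Spiral orders -/

section SpiralOrder

variable {V : Type u} {G : FinHypergraph V} {root u v x y z : V} {r : V → V → Prop}

/-- The part of the notion of a spiral-like ordering that concerns the shape of the hypergraph
alone and not its degrees: a well-ordering with the properties (S1), (S2) and (S4). -/
structure IsSpiralOrder (G : FinHypergraph V) (root : V) (r : V → V → Prop) : Prop where
  isWellOrder : IsWellOrder V r
  height_le : ∀ u v, r u v → G.height root u ≤ G.height root v
  lt_of_isParent : ∀ u v u₁ v₁, G.IsParent root u u₁ → G.IsParent root v v₁ → r u v → r u₁ v₁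
  mem_of_lt_of_lt : ∀ e ∈ G.edges, ∀ a ∈ e, ∀ x ∈ e, ∀ y ∈ e, r a x → ∀ v, r x v → r v y → v ∈ e

theorem IsSLO.isSpiralOrder [DecidableEq V] (h : G.IsSLO root r) : G.IsSpiralOrder root r :=
  ⟨h.isWellOrder, h.s1, h.s2, h.s4⟩

namespace IsSpiralOrder

theorem lt_or_eq_or_gt (h : G.IsSpiralOrder root r) (x y : V) : r x y ∨ x = y ∨ r y x :=
  have := h.isWellOrder
  trichotomous_of r x y

theorem irrefl (h : G.IsSpiralOrder root r) (x : V) : ¬ r x x :=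
  have := h.isWellOrder
  irrefl_of r x

theorem trans (h : G.IsSpiralOrder root r) (hxy : r x y) (hyz : r y z) : r x z :=
  have := h.isWellOrder
  trans_of r hxy hyz

theorem asymm (h : G.IsSpiralOrder root r) (hxy : r x y) : ¬ r y x :=
  fun hyx => h.irrefl x (h.trans hxy hyx)

theorem lt_of_height_lt (h : G.IsSpiralOrder root r) (hxy : G.height root x < G.height root y) :
    r x y := by
  rcases h.lt_or_eq_or_gt x y with hlt | rfl | hgt
  · exact hlt
  · exact absurd hxy (lt_irrefl _)
  · exact absurd (h.height_le _ _ hgt) hxy.not_ge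

theorem root_lt (h : G.IsSpiralOrder root r) (hG : G.adjGraph.Connected) (hv : v ≠ root) :
    r root v :=
  h.lt_of_height_lt (by rw [height_root, height_eq_height_parent_add_one hG hv]; omega)

theorem ne_root_of_lt (h : G.IsSpiralOrder root r) (hG : G.adjGraph.Connected) (huv : r u v) :
    v ≠ root := by
  rintro rfl
  exact h.asymm huv (h.root_lt hG fun huv' => h.irrefl v (huv' ▸ huv))

theorem lt_of_parent_lt (h : G.IsSpiralOrder root r) (hG : G.IsSupertree) (hu : u ≠ root)
    (hv : v ≠ root) (huv : r (G.parent root u) (G.parent root v)) : r u v :=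
  h.lt_of_isParent _ _ _ _ (hG.isParent_parent hu) (hG.isParent_parent hv) huv

end IsSpiralOrder

end SpiralOrder

/-! ### The ordering by ancestors -/

section SpiralKey

theorem append_singleton_lt_append_singleton_iff {α : Type*} [LinearOrder α] {l l' : List α}
    {a a' : α} (h : l.length = l'.length) :
    l ++ [a] < l' ++ [a'] ↔ l < l' ∨ l = l' ∧ a < a' := by
  induction l generalizing l' with
  | nil =>
    obtain rfl : l' = [] := List.eq_nil_of_length_eq_zero h.symm
    simp [List.cons_lt_cons_iff]
  | cons b l ih =>
    obtain ⟨b', l', rfl⟩ := List.exists_cons_of_length_eq_add_one h.symm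
    have hl : l.length = l'.length := Nat.succ_injective h
    simp only [List.cons_append, List.cons_lt_cons_iff, ih hl, List.cons.injEq]
    tauto

theorem exists_injective_forall_le {A : Type*} [Countable A] (w : A → ℝ) :
    ∃ κ : A → ℝ ×ₗ ℕ, κ.Injective ∧ ∀ a b, κ a ≤ κ b → w b ≤ w a := by
  obtain ⟨i, hi⟩ := Countable.exists_injective_nat A
  refine ⟨fun a => toLex (-w a, i a), fun a b h => hi (congrArg (fun p => (ofLex p).2) h),
    fun a b h => ?_⟩
  exact neg_le_neg_iff.1 (Prod.Lex.monotone_fst _ _ h)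

variable {V : Type u} {G : FinHypergraph V} {root u v : V} {β γ : Type*} {ρ : Finset V → β}
  {σ : V → γ}

/-- Vertices other than the root with the same parent are to be ordered first by their parent
edges, according to `ρ`, and then according to `σ`. -/
noncomputable def siblingKey (G : FinHypergraph V) (root : V) (ρ : Finset V → β) (σ : V → γ)
    (v : V) : β ×ₗ γ :=
  toLex (ρ (G.parentEdge root v), σ v)

/-- The sibling keys along the path to `v` from its ancestor `n` generations back. -/
noncomputable def pathKey (G : FinHypergraph V) (root : V) (ρ : Finset V → β) (σ : V → γ) :
    ℕ → V → List (β ×ₗ γ)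
  | 0, v => [G.siblingKey root ρ σ v]
  | n + 1, v => pathKey G root ρ σ n (G.parent root v) ++ [G.siblingKey root ρ σ v]

/-- Vertices are to be ordered by height, vertices of the same height as their parents, and
vertices with the same parent by their sibling keys. -/
noncomputable def spiralKey (G : FinHypergraph V) (root : V) (ρ : Finset V → β) (σ : V → γ)
    (v : V) : ℕ ×ₗ List (β ×ₗ γ) :=
  toLex (G.height root v, G.pathKey root ρ σ (G.height root v) v)

theorem length_pathKey (n : ℕ) (v : V) : (G.pathKey root ρ σ n v).length = n + 1 := by
  induction n generalizing v with
  | zero => rfl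
  | succ n ih => rw [pathKey, List.length_append, ih, List.length_singleton]

theorem getLast?_pathKey (n : ℕ) (v : V) :
    (G.pathKey root ρ σ n v).getLast? = some (G.siblingKey root ρ σ v) := by
  cases n <;> simp [pathKey]

theorem spiralKey_injective (hσ : σ.Injective) : (G.spiralKey root ρ σ).Injective := by
  intro u v h
  have hpath := congrArg (fun p => (ofLex p).2.getLast?) h
  simp only [spiralKey, ofLex_toLex, getLast?_pathKey, Option.some.injEq] at hpath
  exact hσ (congrArg (fun p => (ofLex p).2) hpath)

variable [LinearOrder β] [LinearOrder γ]

theorem height_le_of_spiralKey_le (h : G.spiralKey root ρ σ u ≤ G.spiralKey root ρ σ v) :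
    G.height root u ≤ G.height root v :=
  Prod.Lex.monotone_fst _ _ h

theorem spiralKey_lt_of_height_lt (h : G.height root u < G.height root v) :
    G.spiralKey root ρ σ u < G.spiralKey root ρ σ v :=
  Prod.Lex.toLex_lt_toLex.2 (.inl h)

theorem spiralKey_root_le (hG : G.adjGraph.Connected) (v : V) :
    G.spiralKey root ρ σ root ≤ G.spiralKey root ρ σ v := by
  by_cases hv : v = root
  · rw [hv]
  · refine (spiralKey_lt_of_height_lt ?_).le
    rw [height_root, height_eq_height_parent_add_one hG hv]
    exact Nat.succ_pos _

theorem spiralKey_lt_iff (hG : G.adjGraph.Connected) (hσ : σ.Injective) (hu : u ≠ root)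
    (hv : v ≠ root) (huv : G.height root u = G.height root v) :
    G.spiralKey root ρ σ u < G.spiralKey root ρ σ v ↔
      G.spiralKey root ρ σ (G.parent root u) < G.spiralKey root ρ σ (G.parent root v) ∨
        G.parent root u = G.parent root v ∧
          G.siblingKey root ρ σ u < G.siblingKey root ρ σ v := by
  have hhu := height_eq_height_parent_add_one hG hu
  have hhv := height_eq_height_parent_add_one hG hv
  have hpar : G.height root (G.parent root u) = G.height root (G.parent root v) := by omega
  rw [← (spiralKey_injective (G := G) (root := root) (ρ := ρ) hσ).eq_iff (a := G.parent root u)]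
  simp only [spiralKey, Prod.Lex.toLex_lt_toLex, EmbeddingLike.apply_eq_iff_eq, Prod.mk.injEq, hhu,
    hhv, hpar, lt_irrefl, true_and, false_or, pathKey]
  exact append_singleton_lt_append_singleton_iff (by simp only [length_pathKey])

theorem IsSupertree.spiralKey_lt_of_isParent (hG : G.IsSupertree) (hσ : σ.Injective) {u₁ v₁ : V}
    (hu : G.IsParent root u u₁) (hv : G.IsParent root v v₁)
    (huv : G.spiralKey root ρ σ u < G.spiralKey root ρ σ v) :
    G.spiralKey root ρ σ u₁ < G.spiralKey root ρ σ v₁ := by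
  rcases (height_le_of_spiralKey_le huv.le).lt_or_eq with hlt | heq
  · exact spiralKey_lt_of_height_lt (by rw [hu.2, hv.2]; omega)
  · have hheight : G.height root u₁ = G.height root v₁ := by rw [hu.2, hv.2, heq]
    obtain ⟨hu₁, rfl⟩ := hG.isParent_iff.1 hu
    obtain ⟨hv₁, rfl⟩ := hG.isParent_iff.1 hv
    exact (spiralKey_lt_iff hG.1 hσ hu₁ hv₁ hheight).2 (.inl huv)

theorem IsSupertree.spiralKey_apex_le (hG : G.IsSupertree) {e : Finset V} (he : e ∈ G.edges)
    (hv : v ∈ e) : G.spiralKey root ρ σ (G.apex root e) ≤ G.spiralKey root ρ σ v := by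
  by_cases h : v = G.apex root e
  · rw [← h]
  · exact (spiralKey_lt_of_height_lt (by rw [hG.height_eq he hv h]; omega)).le

theorem IsSupertree.mem_of_spiralKey_lt (hG : G.IsSupertree) (hρ : ρ.Injective)
    (hσ : σ.Injective) {e : Finset V} (he : e ∈ G.edges) {a x y : V} (ha : a ∈ e) (hx : x ∈ e)
    (hy : y ∈ e) (hax : G.spiralKey root ρ σ a < G.spiralKey root ρ σ x)
    (hxv : G.spiralKey root ρ σ x < G.spiralKey root ρ σ v)
    (hvy : G.spiralKey root ρ σ v < G.spiralKey root ρ σ y) : v ∈ e := by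
  have hapex := (hG.spiralKey_apex_le (root := root) (ρ := ρ) (σ := σ) he ha).trans_lt hax
  have hxe : x ≠ G.apex root e := fun h => hapex.ne (h ▸ rfl)
  have hye : y ≠ G.apex root e := fun h => (hapex.trans (hxv.trans hvy)).ne (h ▸ rfl)
  have hheight : G.height root x = G.height root y := by
    rw [hG.height_eq he hx hxe, hG.height_eq he hy hye]
  have hxh := height_le_of_spiralKey_le hxv.le
  have hyh := height_le_of_spiralKey_le hvy.le
  have hx0 := ne_root_of_ne_apex hG.1 hx hxe
  have hv0 : v ≠ root := fun h => hxv.not_ge (h ▸ spiralKey_root_le hG.1 x)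
  rw [spiralKey_lt_iff hG.1 hσ hx0 hv0 (by omega), hG.parent_eq he hx hxe] at hxv
  rw [spiralKey_lt_iff hG.1 hσ hv0 (ne_root_of_ne_apex hG.1 hy hye) (by omega),
    hG.parent_eq he hy hye] at hvy
  rcases hxv with hxv | ⟨hpx, hxv⟩
  · rcases hvy with hvy | ⟨hpy, -⟩
    exacts [absurd hxv hvy.asymm, absurd hxv (hpy ▸ lt_irrefl _)]
  rcases hvy with hvy | ⟨-, hvy⟩
  · exact absurd hvy (hpx ▸ lt_irrefl _)
  have hle := (Prod.Lex.monotone_fst _ _ hxv.le)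
  have hge := (Prod.Lex.monotone_fst _ _ hvy.le)
  simp only [siblingKey, ofLex_toLex, hG.parentEdge_eq he hx hxe,
    hG.parentEdge_eq he hy hye] at hle hge
  exact hρ (hle.antisymm hge) ▸ mem_parentEdge hG.1 hv0

theorem isWellOrder_spiralKey_lt [Finite V] (hσ : σ.Injective) :
    IsWellOrder V fun u v => G.spiralKey root ρ σ u < G.spiralKey root ρ σ v := by
  let : LinearOrder V := LinearOrder.lift' _ (spiralKey_injective (G := G) (root := root)
    (ρ := ρ) hσ)
  exact isWellOrder_lt (α := V)

theorem IsSupertree.isSpiralOrder_spiralKey_lt [Finite V] (hG : G.IsSupertree)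
    (hρ : ρ.Injective) (hσ : σ.Injective) :
    G.IsSpiralOrder root fun u v => G.spiralKey root ρ σ u < G.spiralKey root ρ σ v where
  isWellOrder := isWellOrder_spiralKey_lt hσ
  height_le _ _ huv := height_le_of_spiralKey_le huv.le
  lt_of_isParent _ _ _ _ hu hv := hG.spiralKey_lt_of_isParent hσ hu hv
  mem_of_lt_of_lt _ he _ ha _ hx _ hy hax _ := hG.mem_of_spiralKey_lt hρ hσ he ha hx hy hax

end SpiralKey

namespace IsExtremal

variable {V : Type u} [Fintype V] [DecidableEq V] {G : FinHypergraph V} {k : ℕ} {π : Multiset ℕ}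
  {f : V → ℝ} {root u v : V} {β γ : Type*} [LinearOrder β] [LinearOrder γ] {ρ : Finset V → β}
  {σ : V → γ}

theorem le_of_siblingKey_lt (h : G.IsExtremal k π f root)
    (hρ : ∀ e e', ρ e ≤ ρ e' → ∑ x ∈ e', f x ≤ ∑ x ∈ e, f x) (hσ : ∀ u v, σ u ≤ σ v → f v ≤ f u)
    (hu : u ≠ root) (hv : v ≠ root) (heq : G.parent root u = G.parent root v)
    (hlt : G.siblingKey root ρ σ u < G.siblingKey root ρ σ v) : f v ≤ f u := by
  by_cases hedge : G.parentEdge root u = G.parentEdge root v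
  · simp only [siblingKey, Prod.Lex.toLex_lt_toLex, hedge, lt_irrefl, false_or, true_and] at hlt
    exact hσ _ _ hlt.le
  · exact h.le_of_sum_parentEdge_le hu hv hedge heq (hρ _ _ (Prod.Lex.monotone_fst _ _ hlt.le))

theorem le_of_spiralKey_lt (h : G.IsExtremal k π f root)
    (hρ : ∀ e e', ρ e ≤ ρ e' → ∑ x ∈ e', f x ≤ ∑ x ∈ e, f x) (hσ : ∀ u v, σ u ≤ σ v → f v ≤ f u)
    (hinj : σ.Injective) (hlt : G.spiralKey root ρ σ u < G.spiralKey root ρ σ v) : f v ≤ f u := by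
  induction hn : G.height root u using Nat.strong_induction_on generalizing u v with
  | _ n ih =>
    rcases (height_le_of_spiralKey_le hlt.le).lt_or_eq with hheight | hheight
    · exact h.le_of_height_lt hheight
    have hv : v ≠ root := fun hv => hlt.not_ge (hv ▸ spiralKey_root_le h.connected u)
    by_cases hu : u = root
    · exact hu ▸ h.le_root v
    rcases (spiralKey_lt_iff h.connected hinj hu hv hheight).1 hlt with hpar | ⟨heq, hsib⟩
    · exact h.le_of_parent_le hu hv hheight.le (fun heq => hpar.ne (heq ▸ rfl))
        (ih _ (hn ▸ (parentEdge_spec h.connected hu).2.2) hpar rfl)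
    · exact h.le_of_siblingKey_lt hρ hσ hu hv heq hsib

theorem exists_isSpiralOrder (h : G.IsExtremal k π f root) :
    ∃ r, G.IsSpiralOrder root r ∧ ∀ u v, r u v → f v ≤ f u := by
  obtain ⟨ρ, hρ, hρf⟩ := exists_injective_forall_le fun e : Finset V => ∑ x ∈ e, f x
  obtain ⟨σ, hσ, hσf⟩ := exists_injective_forall_le f
  exact ⟨_, h.isSupertree.isSpiralOrder_spiralKey_lt hρ hσ,
    fun u v => h.le_of_spiralKey_lt hρf hσf hσ⟩

end IsExtremal

end FinHypergraph

namespace FinHypergraph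

/-! ### Monotonicity of the degrees -/

section Edges

variable {V : Type u} {G : FinHypergraph V} {k : ℕ} {f : V → ℝ} {root u v x y : V}
  {e : Finset V} {c : ℝ} {r : V → V → Prop}

theorem IsUniform.sum_le_mul (hG : G.IsUniform k) (he : e ∈ G.edges) (h : ∀ x ∈ e, f x ≤ c) :
    ∑ x ∈ e, f x ≤ k * c := by
  rw [← hG e he, ← nsmul_eq_mul]
  exact Finset.sum_le_card_nsmul _ _ _ h

theorem IsUniform.sum_lt_mul (hG : G.IsUniform k) (he : e ∈ G.edges) (h : ∀ x ∈ e, f x ≤ c)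
    (hx : x ∈ e) (hlt : f x < c) : ∑ x ∈ e, f x < k * c := by
  rw [← hG e he, ← nsmul_eq_mul, ← Finset.sum_const]
  exact Finset.sum_lt_sum h ⟨x, hx, hlt⟩

theorem IsSupertree.exists_isBoundary [Finite V] [Nontrivial V] [DecidableEq V]
    (hG : G.IsSupertree) (hk : 2 ≤ k) (hunif : G.IsUniform k) : ∃ v, G.IsBoundary v := by
  obtain ⟨root⟩ := hG.1.nonempty
  obtain ⟨v, hv⟩ := Finite.exists_max (G.height root)
  have hv0 : v ≠ root := by
    rintro rfl
    obtain ⟨w, hw⟩ := exists_ne v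
    have hle := hv w
    rw [height_root, height_eq_height_parent_add_one hG.1 hw] at hle
    omega
  refine ⟨v, ?_⟩
  by_contra hb
  obtain ⟨e, he, rfl⟩ := hG.exists_apex_eq hb (parentEdge_mem_edges hG.1 hv0)
    (mem_parentEdge hG.1 hv0) (ne_parent hG.1 hv0)
  obtain ⟨y, hy, hye⟩ := hunif.exists_mem_ne hk he (G.apex root e)
  have hle := hv y
  rw [hG.height_eq he hy hye] at hle
  omega

theorem IsSupertree.degree_le_card_filter_add_two [DecidableEq V] (hG : G.IsSupertree) (root : V)
    (huv : u ≠ v) : G.degree u ≤ {e ∈ G.edges | G.apex root e = u ∧ v ∉ e}.card + 2 := by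
  have hsub : {e ∈ G.edges | u ∈ e} ⊆ insert (G.parentEdge root v)
      (insert (G.parentEdge root u) {e ∈ G.edges | G.apex root e = u ∧ v ∉ e}) := by
    intro e he
    obtain ⟨he, hue⟩ := Finset.mem_filter.1 he
    simp only [Finset.mem_insert, Finset.mem_filter]
    by_cases hu : u = G.apex root e
    · by_cases hve : v ∈ e
      · exact .inl (hG.parentEdge_eq he hve (hu ▸ huv.symm)).symm
      · exact .inr (.inr ⟨he, hu.symm, hve⟩)
    · exact .inr (.inl (hG.parentEdge_eq he hue hu).symm)
  calc G.degree u ≤ _ := Finset.card_le_card hsub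
    _ ≤ _ := Finset.card_insert_le _ _
    _ ≤ _ := Nat.add_le_add_right (Finset.card_insert_le _ _) 1

theorem IsSpiralOrder.lt_of_mem_of_covBy (hr : G.IsSpiralOrder root r) (hG : G.IsSupertree)
    (hcov : ∀ w, r u w → ¬ r w v) (he : e ∈ G.edges) (hu : G.apex root e = u) (hve : v ∉ e)
    (hx : x ∈ e) (hxu : x ≠ u) : r v x := by
  subst hu
  rcases hr.lt_or_eq_or_gt v x with hlt | rfl | hgt
  · exact hlt
  · exact absurd hx hve
  · exact absurd hgt (hcov x (hr.lt_of_height_lt (by rw [hG.height_eq he hx hxu]; omega)))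

theorem IsSpiralOrder.linked_of_covBy (hr : G.IsSpiralOrder root r) (hG : G.IsSupertree)
    (hv : v ≠ root) (hcov : ∀ w, r u w → ¬ r w v) :
    G.Linked (fun e => G.apex root e = u → v ∈ e) u v := by
  have hheight : G.height root (G.parent root v) ≤ G.height root u := by
    by_contra! hlt
    exact hcov _ (hr.lt_of_height_lt hlt)
      (hr.lt_of_height_lt (parentEdge_spec hG.1 hv).2.2)
  have hu : G.Linked (fun e => G.apex root e = u → v ∈ e) u root := by
    refine ((hG.isDescendant_root u).linked hG).mono ?_
    rintro e - ⟨-, hlt⟩ rfl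
    exact absurd hlt (lt_irrefl _)
  have hv : G.Linked (fun e => G.apex root e = u → v ∈ e) v root := by
    refine (linked_of_mem_edge (parentEdge_mem_edges hG.1 hv) (fun _ => mem_parentEdge hG.1 hv)
      (mem_parentEdge hG.1 hv) (parent_mem_parentEdge hG.1 hv)).trans
      (((hG.isDescendant_root (G.parent root v)).linked hG).mono ?_)
    rintro e - ⟨-, hlt⟩ rfl
    exact absurd hlt hheight.not_gt
  exact hu.trans hv.symm

theorem IsSpiralOrder.lt_of_apex_eq_of_mem (hr : G.IsSpiralOrder root r) (he : e ∈ G.edges)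
    (hu : G.apex root e = u) (hve : v ∈ e) (huv : r u v) (hx : x ∈ e) (hy : y ∉ e)
    (hvy : r v y) : r x y := by
  rcases hr.lt_or_eq_or_gt x y with hlt | rfl | hgt
  · exact hlt
  · exact absurd hx hy
  · exact absurd (hr.mem_of_lt_of_lt e he u (hu ▸ apex_mem he) v hve x hx huv y hvy hgt) hy

end Edges

namespace IsExtremal

variable {V : Type u} [Fintype V] [DecidableEq V] {G : FinHypergraph V} {k : ℕ} {π : Multiset ℕ}
  {f : V → ℝ} {root u v x y : V} {e : Finset V} {r : V → V → Prop}

theorem sum_le_mul_root (h : G.IsExtremal k π f root) (he : e ∈ G.edges) :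
    ∑ x ∈ e, f x ≤ k * f root :=
  h.isUniform.sum_le_mul he fun x _ => h.le_root x

theorem sum_lt_mul_apex (h : G.IsExtremal k π f root) (he : e ∈ G.edges) (hx : x ∈ e)
    (hlt : f x < f (G.apex root e)) : ∑ x ∈ e, f x < k * f (G.apex root e) :=
  h.isUniform.sum_lt_mul he (fun _ => h.le_apex he) hx hlt

theorem scaledEigenvalue_nonneg (h : G.IsExtremal k π f root) : 0 ≤ G.scaledEigenvalue k := by
  have hlap : 0 ≤ G.lapSum k f root := Finset.sum_nonneg fun e he =>
    sub_nonneg.2 (h.sum_le_mul_root (Finset.mem_filter.1 he).1)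
  rw [h.groundState.lapSum_eq _ (h.groundState.not_isBoundary h.root_pos)] at hlap
  exact nonneg_of_mul_nonneg_left hlap h.root_pos

theorem eq_root_of_scaledEigenvalue_eq_zero (h : G.IsExtremal k π f root)
    (h0 : G.scaledEigenvalue k = 0) (he : e ∈ G.edges) (hx : x ∈ e) (hy : y ∈ e)
    (hyr : f y = f root) : f x = f root := by
  have hlap := h.groundState.lapSum_eq y (h.groundState.not_isBoundary (hyr ▸ h.root_pos))
  rw [h0, zero_mul, lapSum, hyr, Finset.sum_eq_zero_iff_of_nonneg fun e he =>
    sub_nonneg.2 (h.sum_le_mul_root (Finset.mem_filter.1 he).1)] at hlap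
  by_contra hne
  exact (sub_eq_zero.1 (hlap e (Finset.mem_filter.2 ⟨he, hy⟩))).not_gt
    (h.isUniform.sum_lt_mul he (fun x _ => h.le_root x) hx ((h.le_root x).lt_of_ne hne))

theorem scaledEigenvalue_pos [Nontrivial V] (h : G.IsExtremal k π f root) :
    0 < G.scaledEigenvalue k := by
  refine h.scaledEigenvalue_nonneg.lt_of_ne' fun h0 => ?_
  obtain ⟨v, hv⟩ := h.isSupertree.exists_isBoundary h.two_le h.isUniform
  have hconst : f v = f root := by
    suffices hwalk : ∀ x y, G.adjGraph.Walk x y → f y = f root → f x = f root by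
      obtain ⟨p⟩ := h.connected.preconnected v root
      exact hwalk v root p rfl
    intro x y p hy
    induction p with
    | nil => exact hy
    | cons hadj _ ih =>
      obtain ⟨-, e, he, hx, hy'⟩ := hadj
      exact h.eq_root_of_scaledEigenvalue_eq_zero h0 he hx hy' (ih hy)
  exact h.root_pos.ne (h.groundState.vanishes v hv ▸ hconst)

theorem exists_mem_edge_lt [Nontrivial V] (h : G.IsExtremal k π f root) (hu : ¬ G.IsBoundary u) :
    ∃ e ∈ G.edges, u ∈ e ∧ ∃ x ∈ e, f x < f u := by
  have hpos : 0 < G.lapSum k f u := by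
    rw [h.groundState.lapSum_eq u hu]
    exact mul_pos h.scaledEigenvalue_pos (h.groundState.pos u hu)
  obtain ⟨e, he, hlt⟩ := Finset.exists_lt_of_sum_lt (Finset.sum_const_zero.trans_lt hpos)
  obtain ⟨he, hue⟩ := Finset.mem_filter.1 he
  rw [sub_pos, ← h.isUniform e he, ← nsmul_eq_mul, ← Finset.sum_const] at hlt
  exact ⟨e, he, hue, Finset.exists_lt_of_sum_lt hlt⟩

/-- If `f v = f u`, then some edge at `u` contains a vertex `x` with `f x < f u`, since the
eigenvalue is positive. Either this edge is as desired, or `x` precedes the vertices other than `u`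
of the given edge `c`. -/
theorem exists_sum_lt_of_covBy (h : G.IsExtremal k π f root) (hr : G.IsSpiralOrder root r)
    (hfr : ∀ u v, r u v → f v ≤ f u) (hu : ¬ G.IsBoundary u) (huv : r u v)
    (hcov : ∀ w, r u w → ¬ r w v) {c : Finset V} (hc : c ∈ G.edges) (hcu : G.apex root c = u)
    (hvc : v ∉ c) : ∃ e ∈ G.edges, G.apex root e = u ∧ v ∉ e ∧ ∑ x ∈ e, f x < k * f u := by
  have hG := h.isSupertree
  obtain ⟨y, hy, hyu⟩ := h.isUniform.exists_mem_ne h.two_le hc u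
  have hvy : r v y := hr.lt_of_mem_of_covBy hG hcov hc hcu hvc hy hyu
  suffices hlt : f y < f u ∨
      ∃ e ∈ G.edges, G.apex root e = u ∧ v ∉ e ∧ ∃ x ∈ e, f x < f u by
    rcases hlt with hlt | ⟨e, he, rfl, hve, x, hx, hlt⟩
    · exact ⟨c, hc, hcu, hvc, hcu ▸ h.sum_lt_mul_apex hc hy (hcu ▸ hlt)⟩
    · exact ⟨e, he, rfl, hve, h.sum_lt_mul_apex he hx hlt⟩
  rcases (hfr u v huv).lt_or_eq with hlt | -
  · exact .inl ((hfr _ _ hvy).trans_lt hlt)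
  have : Nontrivial V := ⟨y, u, hyu⟩
  obtain ⟨e, he, hue, x, hx, hlt⟩ := h.exists_mem_edge_lt hu
  by_cases heu : G.apex root e = u
  · by_cases hve : v ∈ e
    · refine .inl ((hfr x y (hr.lt_of_apex_eq_of_mem he heu hve huv hx ?_ hvy)).trans_lt hlt)
      exact fun hye => hvc (hG.edge_eq he hc hye hy (heu ▸ hyu) (hcu ▸ hyu) ▸ hve)
    · exact .inr ⟨e, he, heu, hve, x, hx, hlt⟩
  · have hxe : x ≠ G.apex root e := fun hxe => hlt.not_ge (hxe ▸ h.le_apex he hue)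
    refine .inl ((hfr x y (hr.lt_of_height_lt ?_)).trans_lt hlt)
    rw [hG.height_eq he hx hxe, ← hG.height_eq he hue (Ne.symm heu), ← hcu,
      hG.height_eq hc hy (hcu ▸ hyu)]
    omega

/-- Otherwise `deg u - deg v` edges below `u`, among them one as in `exists_sum_lt_of_covBy`, could
be moved to `v`. -/
theorem degree_le_of_covBy (h : G.IsExtremal k π f root) (hr : G.IsSpiralOrder root r)
    (hfr : ∀ u v, r u v → f v ≤ f u) (hu : ¬ G.IsBoundary u) (hv : ¬ G.IsBoundary v)
    (huv : r u v) (hcov : ∀ w, r u w → ¬ r w v) : G.degree u ≤ G.degree v := by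
  by_contra! hlt
  have hG := h.isSupertree
  have hne : u ≠ v := fun heq => hr.irrefl v (heq ▸ huv)
  have hv0 := hr.ne_root_of_lt hG.1 huv
  have hdeg : 2 ≤ G.degree v := by
    have hpos : 0 < G.degree v := Finset.card_pos.2
      ⟨_, Finset.mem_filter.2 ⟨parentEdge_mem_edges hG.1 hv0, mem_parentEdge hG.1 hv0⟩⟩
    exact Nat.lt_of_le_of_ne hpos (Ne.symm hv)
  let C := {e ∈ G.edges | G.apex root e = u ∧ v ∉ e}
  have hcard : G.degree u ≤ C.card + 2 := hG.degree_le_card_filter_add_two root hne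
  obtain ⟨c, hc⟩ : C.Nonempty := Finset.card_pos.1 (by omega)
  obtain ⟨hc, hcu, hvc⟩ := Finset.mem_filter.1 hc
  obtain ⟨l, hl, hlu, hvl, hsum⟩ := h.exists_sum_lt_of_covBy hr hfr hu huv hcov hc hcu hvc
  obtain ⟨M, hlM, hMC, hM⟩ := Finset.exists_subsuperset_card_eq
    (Finset.singleton_subset_iff.2 (Finset.mem_filter.2 ⟨hl, hlu, hvl⟩ : l ∈ C))
    (n := G.degree u - G.degree v) (by rw [Finset.card_singleton]; omega)
    (Nat.sub_le_iff_le_add.2 (hcard.trans (Nat.add_le_add_left hdeg _)))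
  have hMC : ∀ e ∈ M, e ∈ G.edges ∧ G.apex root e = u ∧ v ∉ e :=
    fun e he => Finset.mem_filter.1 (hMC he)
  have hex : G.IsExchange M ∅ u v := by
    refine isExchange_of_linked hG.1 (fun e he => (hMC e he).1) (Finset.empty_subset _)
      (Finset.disjoint_empty_right _) (fun e he => (hMC e he).2.1 ▸ apex_mem (hMC e he).1)
      (by simp) hne ((hr.linked_of_covBy hG hv0 hcov).mono fun e _ hev => ?_)
    exact ⟨fun he => (hMC e he).2.2 (hev (hMC e he).2.1), Finset.notMem_empty e⟩
  refine hsum.not_ge (hex.mul_le_sum h.two_le h.faberKrahn h.groundState hu hv (by omega)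
    (hfr u v huv) (fun e he x hx hxu => hfr _ _ ?_) (Finset.singleton_subset_iff.1 hlM))
  exact hr.lt_of_mem_of_covBy hG hcov (hMC e he).1 (hMC e he).2.1 (hMC e he).2.2 hx hxu

theorem degree_le (h : G.IsExtremal k π f root) (hr : G.IsSpiralOrder root r)
    (hfr : ∀ u v, r u v → f v ≤ f u) (hv : ¬ G.IsBoundary v) (huv : r u v) :
    G.degree u ≤ G.degree v := by
  have := hr.isWellOrder
  induction v using IsWellFounded.induction r with
  | _ v ih =>
    obtain ⟨w, ⟨huw, hwv⟩, hmax⟩ :=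
      (Finite.wellFounded_of_trans_of_irrefl (Function.swap r)).has_min
        {w | (u = w ∨ r u w) ∧ r w v} ⟨u, .inl rfl, huv⟩
    have hw : ¬ G.IsBoundary w :=
      h.groundState.not_isBoundary ((h.groundState.pos v hv).trans_le (hfr _ _ hwv))
    have hcov : ∀ x, r w x → ¬ r x v := fun x hwx hxv =>
      hmax x ⟨.inr (huw.elim (fun huw => huw ▸ hwx) fun huw => hr.trans huw hwx), hxv⟩ hwx
    refine le_trans ?_ (h.degree_le_of_covBy hr hfr hw hv hwv hcov)
    rcases huw with rfl | huw
    exacts [le_rfl, ih w hwv hw huw]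

end IsExtremal

section Existence

variable {V : Type u} [Finite V] [DecidableEq V] {G : FinHypergraph V}

theorem IsSupertree.hasSLO_of_forall_isBoundary (hG : G.IsSupertree)
    (hbd : ∀ v, G.IsBoundary v) : G.HasSLO := by
  obtain ⟨root⟩ := hG.1.nonempty
  obtain ⟨ρ, hρ⟩ := Countable.exists_injective_nat (Finset V)
  obtain ⟨σ, hσ⟩ := Countable.exists_injective_nat V
  have hr := hG.isSpiralOrder_spiralKey_lt (root := root) hρ hσ
  exact ⟨root, _, hr.isWellOrder, hr.height_le, hr.lt_of_isParent, fun _ v _ _ => hbd v,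
    hr.mem_of_lt_of_lt, fun u _ hu => absurd (hbd u) hu⟩

end Existence

section Existence

variable {V : Type u} [Fintype V] [DecidableEq V] {G : FinHypergraph V} {k : ℕ} {π : Multiset ℕ}
  {f : V → ℝ} {root : V}

theorem IsExtremal.hasSLO (h : G.IsExtremal k π f root) : G.HasSLO := by
  obtain ⟨r, hr, hfr⟩ := h.exists_isSpiralOrder
  refine ⟨root, r, hr.isWellOrder, hr.height_le, hr.lt_of_isParent, fun u v huv hu => ?_,
    hr.mem_of_lt_of_lt, fun u v _ hv => h.degree_le hr hfr hv⟩
  by_contra hv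
  exact (h.groundState.pos v hv).not_ge (h.groundState.vanishes u hu ▸ hfr u v huv)

theorem HasFaberKrahn.hasSLO (hk : 2 ≤ k) (hFK : G.HasFaberKrahn k π) : G.HasSLO := by
  have hG := hFK.1.isSupertree
  by_cases hint : ∃ v, ¬ G.IsBoundary v
  · obtain ⟨f, hf⟩ := exists_isGroundState hk hFK.1.isUniform hG.1 hint
    have := hG.1.nonempty
    obtain ⟨root, hroot⟩ := Finite.exists_max f
    exact IsExtremal.hasSLO ⟨hk, hFK, hf, hint, hroot⟩
  · exact hG.hasSLO_of_forall_isBoundary (by simpa using hint)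

end Existence

end FinHypergraph

namespace FinHypergraph

/-! ### Counting edges along a spiral order -/

section Counting

variable {V : Type u} {G : FinHypergraph V} {k : ℕ} {root u v w x y : V} {e : Finset V}
  {r : V → V → Prop}

open Classical in
/-- The edges all of whose vertices other than the apex precede `w`. -/
noncomputable def edgesBefore (G : FinHypergraph V) (root : V) (r : V → V → Prop) (w : V) :
    Finset (Finset V) :=
  {e ∈ G.edges | ∀ x ∈ e, x ≠ G.apex root e → r x w}

open Classical in
/-- The edges whose apex is `u` or precedes `u`. -/
noncomputable def edgesUpTo (G : FinHypergraph V) (root : V) (r : V → V → Prop) (u : V) :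
    Finset (Finset V) :=
  {e ∈ G.edges | r (G.apex root e) u ∨ G.apex root e = u}

theorem mem_edgesBefore :
    e ∈ G.edgesBefore root r w ↔ e ∈ G.edges ∧ ∀ x ∈ e, x ≠ G.apex root e → r x w := by
  classical
  exact Finset.mem_filter

theorem mem_edgesUpTo :
    e ∈ G.edgesUpTo root r u ↔ e ∈ G.edges ∧ (r (G.apex root e) u ∨ G.apex root e = u) := by
  classical
  exact Finset.mem_filter

theorem IsSupertree.card_filter_apex_eq [DecidableEq V] (hG : G.IsSupertree) (x : V) :
    {e ∈ G.edges | G.apex root e = x}.card = G.degree x - if x = root then 0 else 1 := by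
  split_ifs with hx
  · rw [Nat.sub_zero, degree]
    refine congrArg _ (Finset.filter_congr fun e he => ⟨fun h => h ▸ apex_mem he, fun hxe => ?_⟩)
    by_contra hne
    exact ne_root_of_ne_apex hG.1 hxe (Ne.symm hne) hx
  · have hp : G.parentEdge root x ∈ {e ∈ G.edges | x ∈ e} :=
      Finset.mem_filter.2 ⟨parentEdge_mem_edges hG.1 hx, mem_parentEdge hG.1 hx⟩
    rw [degree, ← Finset.card_erase_of_mem hp]
    congr 1
    ext e
    simp only [Finset.mem_filter, Finset.mem_erase]
    refine ⟨?_, fun ⟨hne, he, hxe⟩ => ⟨he, ?_⟩⟩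
    · rintro ⟨he, rfl⟩
      exact ⟨fun heq => ne_parent hG.1 hx (congrArg (G.apex root) heq), he, apex_mem he⟩
    · by_contra h
      exact hne (hG.parentEdge_eq he hxe (Ne.symm h)).symm

open Classical in
theorem IsSupertree.card_edgesUpTo [Fintype V] [DecidableEq V] (hG : G.IsSupertree)
    (r : V → V → Prop) (u : V) :
    (G.edgesUpTo root r u).card =
      ∑ x with r x u ∨ x = u, (G.degree x - if x = root then 0 else 1) := by
  rw [Finset.card_eq_sum_card_fiberwise (f := G.apex root)
    (t := Finset.univ.filter fun x => r x u ∨ x = u) fun e he => by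
      simpa using (mem_edgesUpTo.1 he).2]
  refine Finset.sum_congr rfl fun x hx => ?_
  rw [← hG.card_filter_apex_eq]
  congr 1
  ext e
  simp only [Finset.mem_filter, mem_edgesUpTo, and_assoc, and_congr_right_iff,
    and_iff_right_iff_imp]
  rintro - rfl
  exact (Finset.mem_filter.1 hx).2

namespace IsSpiralOrder

theorem apex_lt (hr : G.IsSpiralOrder root r) (hG : G.IsSupertree) (he : e ∈ G.edges) (hx : x ∈ e)
    (hxe : x ≠ G.apex root e) : r (G.apex root e) x :=
  hr.lt_of_height_lt (by rw [hG.height_eq he hx hxe]; omega)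

theorem parentEdge_eq_of_between (hr : G.IsSpiralOrder root r) (hG : G.IsSupertree)
    (he : e ∈ G.edges) (hx : x ∈ e) (hxe : x ≠ G.apex root e) (hy : y ∈ e) (hxw : r x w)
    (hwy : r w y) : G.parentEdge root w = e := by
  have hlt := hr.apex_lt hG he hx hxe
  refine hG.parentEdge_eq he (hr.mem_of_lt_of_lt e he _ (apex_mem he) x hx y hy hlt w hxw hwy) ?_
  rintro rfl
  exact hr.asymm hlt hxw

theorem mem_edgesBefore_of_lt (hr : G.IsSpiralOrder root r) (hG : G.IsSupertree)
    (he : e ∈ G.edges) (hw : G.parentEdge root w ≠ e) (hx : x ∈ e) (hxe : x ≠ G.apex root e)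
    (hxw : r x w) : e ∈ G.edgesBefore root r w := by
  refine mem_edgesBefore.2 ⟨he, fun y hy hye => ?_⟩
  rcases hr.lt_or_eq_or_gt y w with hlt | rfl | hgt
  · exact hlt
  · exact absurd (hG.parentEdge_eq he hy hye) hw
  · exact absurd (hr.parentEdge_eq_of_between hG he hx hxe hy hxw hgt) hw

theorem parentEdge_notMem_edgesBefore (hr : G.IsSpiralOrder root r) (hG : G.adjGraph.Connected)
    (hw : w ≠ root) : G.parentEdge root w ∉ G.edgesBefore root r w := fun h =>
  hr.irrefl w ((mem_edgesBefore.1 h).2 w (mem_parentEdge hG hw) (ne_parent hG hw))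

open Classical in
theorem card_filter_erase_apex_lt (hr : G.IsSpiralOrder root r) (hG : G.IsSupertree)
    (hunif : G.IsUniform k) (he : e ∈ G.edges) (hw : G.parentEdge root w ≠ e) :
    {x ∈ e.erase (G.apex root e) | r x w}.card =
      if e ∈ G.edgesBefore root r w then k - 1 else 0 := by
  split_ifs with hmem
  · rw [Finset.filter_true_of_mem, Finset.card_erase_of_mem (apex_mem he), hunif e he]
    exact fun x hx => (mem_edgesBefore.1 hmem).2 x (Finset.mem_of_mem_erase hx)
      (Finset.ne_of_mem_erase hx)
  · rw [Finset.card_eq_zero, Finset.filter_eq_empty_iff]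
    exact fun x hx hxw => hmem (hr.mem_edgesBefore_of_lt hG he hw (Finset.mem_of_mem_erase hx)
      (Finset.ne_of_mem_erase hx) hxw)

open Classical in
theorem card_filter_lt_sub_one [Fintype V] (hr : G.IsSpiralOrder root r) (hG : G.IsSupertree)
    (hw : w ≠ root) : ({x | r x w} : Finset V).card - 1 =
      ∑ e ∈ G.edges, {x ∈ e.erase (G.apex root e) | r x w}.card := by
  have hroot : root ∈ ({x | r x w} : Finset V) := by simpa using hr.root_lt hG.1 hw
  rw [← Finset.card_erase_of_mem hroot, Finset.card_eq_sum_card_fiberwise (f := G.parentEdge root)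
    (t := G.edges) fun x hx => parentEdge_mem_edges hG.1 (Finset.ne_of_mem_erase hx)]
  refine Finset.sum_congr rfl fun e he => ?_
  rw [← hG.filter_parentEdge_eq he]
  congr 1
  ext x
  simp only [Finset.mem_filter, Finset.mem_erase, Finset.mem_univ, true_and]
  tauto

open Classical in
/-- Every edge before `w` contributes `k - 1` predecessors of `w`, the edge above `w` contributes
fewer than `k - 1`, and the root accounts for the remaining one. -/
theorem card_edgesBefore [Fintype V] (hr : G.IsSpiralOrder root r) (hG : G.IsSupertree)
    (hunif : G.IsUniform k) (hw : w ≠ root) : (G.edgesBefore root r w).card =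
      (({x | r x w} : Finset V).card - 1) / (k - 1) := by
  have hp := parentEdge_mem_edges hG.1 hw
  have hothers : ∑ e ∈ G.edges.erase (G.parentEdge root w),
      {x ∈ e.erase (G.apex root e) | r x w}.card = (G.edgesBefore root r w).card * (k - 1) := by
    rw [Finset.sum_congr rfl fun e he => hr.card_filter_erase_apex_lt hG hunif
      (Finset.mem_of_mem_erase he) (Finset.ne_of_mem_erase he).symm, ← Finset.sum_filter,
      Finset.sum_const, smul_eq_mul]
    congr 2
    ext e
    simp only [Finset.mem_filter, Finset.mem_erase, and_iff_right_iff_imp]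
    exact fun he => ⟨fun heq => hr.parentEdge_notMem_edgesBefore hG.1 hw (heq ▸ he),
      (mem_edgesBefore.1 he).1⟩
  have hlast : {x ∈ (G.parentEdge root w).erase (G.parent root w) | r x w}.card < k - 1 := by
    rw [← hunif _ hp, ← Finset.card_erase_of_mem (apex_mem (root := root) hp)]
    exact Finset.card_lt_card (Finset.filter_ssubset.2
      ⟨w, Finset.mem_erase.2 ⟨ne_parent hG.1 hw, mem_parentEdge hG.1 hw⟩, hr.irrefl w⟩)
  rw [hr.card_filter_lt_sub_one hG hw, ← Finset.add_sum_erase _ _ hp, hothers,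
    Nat.add_mul_div_right _ _ (by omega)]
  exact (Nat.add_eq_right.2 (Nat.div_eq_of_lt hlast)).symm

theorem edgesBefore_subset (hr : G.IsSpiralOrder root r) (hvw : r v w) :
    G.edgesBefore root r v ⊆ G.edgesBefore root r w := fun _ he =>
  mem_edgesBefore.2 ⟨(mem_edgesBefore.1 he).1, fun x hx hxe =>
    hr.trans ((mem_edgesBefore.1 he).2 x hx hxe) hvw⟩

theorem card_edgesBefore_lt (hr : G.IsSpiralOrder root r) (hG : G.IsSupertree) (hv : v ≠ root)
    (hvw : r v w) (hne : G.parentEdge root v ≠ G.parentEdge root w) :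
    (G.edgesBefore root r v).card < (G.edgesBefore root r w).card := by
  refine Finset.card_lt_card ⟨hr.edgesBefore_subset hvw, fun hsub => ?_⟩
  exact hr.parentEdge_notMem_edgesBefore hG.1 hv (hsub (hr.mem_edgesBefore_of_lt hG
    (parentEdge_mem_edges hG.1 hv) hne.symm (mem_parentEdge hG.1 hv) (ne_parent hG.1 hv) hvw))

theorem edgesBefore_eq_of_parentEdge_eq (hr : G.IsSpiralOrder root r) (hG : G.IsSupertree)
    (hv : v ≠ root) (hvw : r v w) (heq : G.parentEdge root v = G.parentEdge root w) :
    G.edgesBefore root r v = G.edgesBefore root r w := by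
  have hw := hr.ne_root_of_lt hG.1 hvw
  refine (hr.edgesBefore_subset hvw).antisymm fun e he => ?_
  obtain ⟨he', hall⟩ := mem_edgesBefore.1 he
  have hne : G.parentEdge root v ≠ e := by
    rintro rfl
    exact hr.parentEdge_notMem_edgesBefore hG.1 hw (heq ▸ he)
  refine mem_edgesBefore.2 ⟨he', fun x hx hxe => ?_⟩
  rcases hr.lt_or_eq_or_gt x v with hlt | rfl | hgt
  · exact hlt
  · exact absurd (hG.parentEdge_eq he' hx hxe) hne
  · refine absurd ?_ hne
    rw [← hG.parentEdge_eq he' hx hxe]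
    exact (hr.parentEdge_eq_of_between hG (parentEdge_mem_edges hG.1 hv) (mem_parentEdge hG.1 hv)
      (ne_parent hG.1 hv) (heq ▸ mem_parentEdge hG.1 hw) hgt (hall x hx hxe)).symm

theorem parentEdge_eq_iff (hr : G.IsSpiralOrder root r) (hG : G.IsSupertree) (hv : v ≠ root)
    (hw : w ≠ root) : G.parentEdge root v = G.parentEdge root w ↔
      (G.edgesBefore root r v).card = (G.edgesBefore root r w).card := by
  wlog hvw : r v w generalizing v w
  · rcases hr.lt_or_eq_or_gt v w with hlt | rfl | hgt
    · exact absurd hlt hvw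
    · simp only
    · rw [eq_comm, this hw hv hgt, eq_comm]
  refine ⟨fun heq => by rw [hr.edgesBefore_eq_of_parentEdge_eq hG hv hvw heq], fun hcard => ?_⟩
  by_contra hne
  exact (hr.card_edgesBefore_lt hG hv hvw hne).ne hcard

theorem edgesBefore_ssubset_edgesUpTo (hr : G.IsSpiralOrder root r) (hG : G.IsSupertree)
    (hk : 2 ≤ k) (hunif : G.IsUniform k) (hw : w ≠ root)
    (hle : r (G.parent root w) u ∨ G.parent root w = u) :
    G.edgesBefore root r w ⊂ G.edgesUpTo root r u := by
  refine ⟨fun e he => ?_, fun hsub => hr.parentEdge_notMem_edgesBefore hG.1 hw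
    (hsub (mem_edgesUpTo.2 ⟨parentEdge_mem_edges hG.1 hw, hle⟩))⟩
  obtain ⟨he, hall⟩ := mem_edgesBefore.1 he
  refine mem_edgesUpTo.2 ⟨he, ?_⟩
  obtain ⟨x, hx, hxe⟩ := hunif.exists_mem_ne hk he (G.apex root e)
  rcases hr.lt_or_eq_or_gt (G.apex root e) (G.parent root w) with hlt | heq | hgt
  · exact .inl (hle.elim (hr.trans hlt) fun hu => hu ▸ hlt)
  · rwa [heq]
  · rw [← hG.parent_eq he hx hxe] at hgt
    exact absurd (hall x hx hxe)
      (hr.asymm (hr.lt_of_parent_lt hG hw (ne_root_of_ne_apex hG.1 hx hxe) hgt))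

theorem edgesUpTo_subset_edgesBefore (hr : G.IsSpiralOrder root r) (hG : G.IsSupertree)
    (hw : w ≠ root) (hlt : r u (G.parent root w)) :
    G.edgesUpTo root r u ⊆ G.edgesBefore root r w := by
  intro e he
  obtain ⟨he, hle⟩ := mem_edgesUpTo.1 he
  refine mem_edgesBefore.2 ⟨he, fun x hx hxe =>
    hr.lt_of_parent_lt hG (ne_root_of_ne_apex hG.1 hx hxe) hw ?_⟩
  rw [hG.parent_eq he hx hxe]
  exact hle.elim (fun h => hr.trans h hlt) fun h => h ▸ hlt

theorem parent_le_iff (hr : G.IsSpiralOrder root r) (hG : G.IsSupertree) (hk : 2 ≤ k)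
    (hunif : G.IsUniform k) (hw : w ≠ root) (u : V) :
    r (G.parent root w) u ∨ G.parent root w = u ↔
      (G.edgesBefore root r w).card < (G.edgesUpTo root r u).card := by
  refine ⟨fun hle => Finset.card_lt_card (hr.edgesBefore_ssubset_edgesUpTo hG hk hunif hw hle),
    fun hcard => ?_⟩
  rcases hr.lt_or_eq_or_gt (G.parent root w) u with hlt | heq | hgt
  · exact .inl hlt
  · exact .inr heq
  · exact absurd (Finset.card_le_card (hr.edgesUpTo_subset_edgesBefore hG hw hgt)) hcard.not_ge

end IsSpiralOrder

end Counting

end FinHypergraph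

namespace FinHypergraph

/-! ### Uniqueness -/

section Unique

variable {V W : Type u} {G : FinHypergraph V} {H : FinHypergraph W} {rootG x y : V} {rootH : W}
  {r : V → V → Prop} {s : W → W → Prop} {k : ℕ}

theorem IsSpiralOrder.map_root (hr : G.IsSpiralOrder rootG r) (hs : H.IsSpiralOrder rootH s)
    (hG : G.adjGraph.Connected) (hH : H.adjGraph.Connected) (φ : r ≃r s) : φ rootG = rootH := by
  by_contra hne
  have hlt := hs.root_lt hH hne
  rw [← φ.apply_symm_apply rootH, φ.map_rel_iff] at hlt
  exact hr.ne_root_of_lt hG hlt rfl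

variable [Finite V]

theorem IsSpiralOrder.card_edgesBefore_map (hr : G.IsSpiralOrder rootG r)
    (hs : H.IsSpiralOrder rootH s) (hG : G.IsSupertree) (hH : H.IsSupertree)
    (hGk : G.IsUniform k) (hHk : H.IsUniform k) (φ : r ≃r s) (hx : x ≠ rootG) :
    (H.edgesBefore rootH s (φ x)).card = (G.edgesBefore rootG r x).card := by
  classical
  have := Fintype.ofFinite V
  have := Fintype.ofEquiv V φ.toEquiv
  have hφx : φ x ≠ rootH := hr.map_root hs hG.1 hH.1 φ ▸ φ.injective.ne hx
  rw [hr.card_edgesBefore hG hGk hx, hs.card_edgesBefore hH hHk hφx]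
  congr 2
  exact (Finset.card_equiv φ.toEquiv fun y => by simp [φ.map_rel_iff]).symm

variable [DecidableEq V] [DecidableEq W]

theorem IsSpiralOrder.card_edgesUpTo_map (hr : G.IsSpiralOrder rootG r)
    (hs : H.IsSpiralOrder rootH s) (hG : G.IsSupertree) (hH : H.IsSupertree) (φ : r ≃r s)
    (hdeg : ∀ x, H.degree (φ x) = G.degree x) (x : V) :
    (H.edgesUpTo rootH s (φ x)).card = (G.edgesUpTo rootG r x).card := by
  classical
  have := Fintype.ofFinite V
  have := Fintype.ofEquiv V φ.toEquiv
  rw [hG.card_edgesUpTo, hH.card_edgesUpTo, ← hr.map_root hs hG.1 hH.1 φ]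
  refine (Finset.sum_equiv φ.toEquiv (fun y => ?_) fun y _ => ?_).symm
  · simp [φ.map_rel_iff]
  · simp [hdeg]

/-- The parent of `x` is the first vertex up to which there are more edges than before `x`, and
`φ` preserves both numbers of edges. -/
theorem IsSpiralOrder.map_parent (hr : G.IsSpiralOrder rootG r) (hs : H.IsSpiralOrder rootH s)
    (hk : 2 ≤ k) (hG : G.IsSupertree) (hH : H.IsSupertree) (hGk : G.IsUniform k)
    (hHk : H.IsUniform k) (φ : r ≃r s) (hdeg : ∀ x, H.degree (φ x) = G.degree x)
    (hx : x ≠ rootG) : φ (G.parent rootG x) = H.parent rootH (φ x) := by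
  have hφx : φ x ≠ rootH := hr.map_root hs hG.1 hH.1 φ ▸ φ.injective.ne hx
  have hiff : ∀ u, r (G.parent rootG x) u ∨ G.parent rootG x = u ↔
      s (H.parent rootH (φ x)) (φ u) ∨ H.parent rootH (φ x) = φ u := fun u => by
    rw [hr.parent_le_iff hG hk hGk hx, hs.parent_le_iff hH hk hHk hφx,
      hr.card_edgesBefore_map hs hG hH hGk hHk φ hx, hr.card_edgesUpTo_map hs hG hH φ hdeg]
  obtain ⟨u, hu⟩ := φ.surjective (H.parent rootH (φ x))
  have hge := (hiff u).2 (.inr hu.symm)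
  rw [← φ.map_rel_iff, ← φ.injective.eq_iff, hu] at hge
  rcases (hiff (G.parent rootG x)).1 (.inr rfl) with hlt | heq
  · exact hge.resolve_left (hs.asymm hlt)
  · exact heq.symm

theorem IsSpiralOrder.map_mem_edges (hr : G.IsSpiralOrder rootG r) (hs : H.IsSpiralOrder rootH s)
    (hk : 2 ≤ k) (hG : G.IsSupertree) (hH : H.IsSupertree) (hGk : G.IsUniform k)
    (hHk : H.IsUniform k) (φ : r ≃r s) (hdeg : ∀ x, H.degree (φ x) = G.degree x)
    {e : Finset V} (he : e ∈ G.edges) : e.map φ.toEquiv.toEmbedding ∈ H.edges := by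
  have hroot := hr.map_root hs hG.1 hH.1 φ
  obtain ⟨x, hx, hxe⟩ := hGk.exists_mem_ne hk he (G.apex rootG e)
  have hx0 := ne_root_of_ne_apex hG.1 hx hxe
  have hφx : φ x ≠ rootH := hroot ▸ φ.injective.ne hx0
  have hsub : e.map φ.toEquiv.toEmbedding ⊆ H.parentEdge rootH (φ x) := by
    intro _ hmem
    obtain ⟨y, hy, rfl⟩ := Finset.mem_map.1 hmem
    change φ y ∈ _
    by_cases hye : y = G.apex rootG e
    · rw [hye, ← hG.parent_eq he hx hxe, hr.map_parent hs hk hG hH hGk hHk φ hdeg hx0]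
      exact parent_mem_parentEdge hH.1 hφx
    · have hy0 := ne_root_of_ne_apex hG.1 hy hye
      have hφy : φ y ≠ rootH := hroot ▸ φ.injective.ne hy0
      have heq := (hr.parentEdge_eq_iff hG hy0 hx0).1
        ((hG.parentEdge_eq he hy hye).trans (hG.parentEdge_eq he hx hxe).symm)
      rw [← hr.card_edgesBefore_map hs hG hH hGk hHk φ hy0,
        ← hr.card_edgesBefore_map hs hG hH hGk hHk φ hx0, ← hs.parentEdge_eq_iff hH hφy hφx] at heq
      exact heq ▸ mem_parentEdge hH.1 hφy
  have hp := parentEdge_mem_edges hH.1 hφx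
  rwa [Finset.eq_of_subset_of_card_le hsub (by rw [Finset.card_map, hGk e he, hHk _ hp])]

end Unique

section Enumeration

/-- The degrees, with the boundary degree `1` moved to the end: a spiral-like ordering visits the
vertices by increasing key. -/
noncomputable def degreeKey (d : ℕ) : ℕ∞ := if d = 1 then ⊤ else d

theorem degreeKey_injective : Function.Injective degreeKey := by
  intro a b h
  unfold degreeKey at h
  split_ifs at h with ha hb hb
  · exact ha.trans hb.symm
  · exact absurd h.symm (ENat.natCast_ne_top b)
  · exact absurd h (ENat.natCast_ne_top a)
  · exact_mod_cast h

theorem exists_fin_relIso {V : Type u} [Fintype V] {n : ℕ} (r : V → V → Prop) [IsWellOrder V r]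
    (hn : Fintype.card V = n) :
    Nonempty (((· < ·) : Fin n → Fin n → Prop) ≃r r) := by
  classical
  let _ : LinearOrder V := linearOrderOfSTO r
  exact ⟨(monoEquivOfFin V hn).toRelIsoLT⟩

variable {V W : Type u} [DecidableEq V] [DecidableEq W] {G : FinHypergraph V} {H : FinHypergraph W}
  {k n : ℕ} {π : Multiset ℕ} {rootG : V} {rootH : W} {r : V → V → Prop} {s : W → W → Prop}

theorem IsSLO.degreeKey_le (h : G.IsSLO rootG r) {u v : V} (huv : r u v) :
    degreeKey (G.degree u) ≤ degreeKey (G.degree v) := by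
  by_cases hv : G.degree v = 1
  · exact le_top.trans_eq (if_pos hv).symm
  · have hu : G.degree u ≠ 1 := fun hu => hv (h.s3 _ _ huv hu)
    rw [degreeKey, degreeKey, if_neg hu, if_neg hv]
    exact_mod_cast h.s5 _ _ hu hv huv

theorem IsSLO.sortedLE_ofFn_degreeKey (h : G.IsSLO rootG r)
    (α : ((· < ·) : Fin n → Fin n → Prop) ≃r r) :
    (List.ofFn fun i => degreeKey (G.degree (α i))).SortedLE :=
  Monotone.sortedLE_ofFn (monotone_iff_forall_lt.2 fun _ _ hij =>
    h.degreeKey_le (α.map_rel_iff.2 hij))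

variable [Fintype V] [Fintype W]

theorem MemClass.card_eq (h : G.MemClass k π) : Fintype.card V = π.card := by
  rw [← h.degreeSequence_eq, degreeSequence, Multiset.card_map, Finset.card_val, Finset.card_univ]

theorem coe_ofFn_degreeKey (α : Fin n ≃ V) :
    ↑(List.ofFn fun i => degreeKey (G.degree (α i))) = G.degreeSequence.map degreeKey := by
  rw [← Fin.univ_val_map, degreeSequence, ← Multiset.map_univ_val_equiv α, Multiset.map_map,
    Multiset.map_map]
  rfl

theorem IsSLO.degree_eq (hr : G.IsSLO rootG r) (hs : H.IsSLO rootH s)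
    (hd : G.degreeSequence = H.degreeSequence) (φ : r ≃r s) (x : V) :
    H.degree (φ x) = G.degree x := by
  have := hr.isWellOrder
  obtain ⟨α⟩ := exists_fin_relIso r rfl
  have hperm : (List.ofFn fun i => degreeKey (G.degree (α i))).Perm
      (List.ofFn fun i => degreeKey (H.degree (α.trans φ i))) :=
    Multiset.coe_eq_coe.1 ((coe_ofFn_degreeKey α.toEquiv).trans
      ((congrArg _ hd).trans (coe_ofFn_degreeKey (α.trans φ).toEquiv).symm))
  have heq := List.ofFn_injective
    (hperm.eq_of_sortedLE (hr.sortedLE_ofFn_degreeKey α) (hs.sortedLE_ofFn_degreeKey (α.trans φ)))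
  obtain ⟨i, rfl⟩ := α.surjective x
  exact (degreeKey_injective (congrFun heq i)).symm

theorem HasSLO.isIsomorphic (hk : 2 ≤ k) (hG : G.MemClass k π) (hH : H.MemClass k π)
    (hGs : G.HasSLO) (hHs : H.HasSLO) : G.IsIsomorphic H := by
  obtain ⟨rootG, r, hr⟩ := hGs
  obtain ⟨rootH, s, hs⟩ := hHs
  have := hr.isWellOrder
  have := hs.isWellOrder
  obtain ⟨α⟩ := exists_fin_relIso r hG.card_eq
  obtain ⟨β⟩ := exists_fin_relIso s hH.card_eq
  have hd := hG.degreeSequence_eq.trans hH.degreeSequence_eq.symm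
  let φ : r ≃r s := α.symm.trans β
  refine ⟨φ.toEquiv, fun e => ⟨hr.isSpiralOrder.map_mem_edges hs.isSpiralOrder hk hG.isSupertree
    hH.isSupertree hG.isUniform hH.isUniform φ (hr.degree_eq hs hd φ), fun he => ?_⟩⟩
  have hmem := hs.isSpiralOrder.map_mem_edges hr.isSpiralOrder hk hH.isSupertree hG.isSupertree
    hH.isUniform hG.isUniform φ.symm (hs.degree_eq hr hd.symm φ.symm) he
  rw [Finset.map_map] at hmem
  simpa using hmem

end Enumeration

/-! ### Isomorphisms -/

section Transport

variable {V W : Type u} {G : FinHypergraph V} {H : FinHypergraph W} {φ : V ≃ W} {k : ℕ}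
  {π : Multiset ℕ} {μ : ℝ}

theorem mem_edges_symm_iff (hφ : ∀ e : Finset V, e ∈ G.edges ↔ e.map φ.toEmbedding ∈ H.edges)
    (e : Finset W) : e ∈ H.edges ↔ e.map φ.symm.toEmbedding ∈ G.edges := by
  rw [hφ, Finset.map_map]
  simp

theorem IsIsomorphic.symm (h : G.IsIsomorphic H) : H.IsIsomorphic G :=
  h.imp' Equiv.symm fun _ => mem_edges_symm_iff

theorem IsIsomorphic.isUniform (h : G.IsIsomorphic H) (hG : G.IsUniform k) : H.IsUniform k := by
  obtain ⟨φ, hφ⟩ := h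
  intro e he
  rw [← hG _ ((mem_edges_symm_iff hφ e).1 he), Finset.card_map]

theorem IsIsomorphic.connected (h : G.IsIsomorphic H) (hG : G.adjGraph.Connected) :
    H.adjGraph.Connected := by
  obtain ⟨φ, hφ⟩ := h
  let F : G.adjGraph →g H.adjGraph := ⟨φ, fun ⟨hne, e, he, ha, hb⟩ => ⟨φ.injective.ne hne,
    e.map φ.toEmbedding, (hφ e).1 he, Finset.mem_map_of_mem _ ha, Finset.mem_map_of_mem _ hb⟩⟩
  exact hG.map F φ.surjective

theorem IsIsomorphic.hasCycle (h : G.IsIsomorphic H) (hG : G.HasCycle) : H.HasCycle := by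
  obtain ⟨φ, hφ⟩ := h
  obtain ⟨m, x, e, hx, he, hxe⟩ := hG
  refine ⟨m, fun i => φ (x i), fun i => (e i).map φ.toEmbedding, φ.injective.comp hx,
    (Finset.map_injective _).comp he, fun i => ?_⟩
  obtain ⟨hei, hxi, hxi'⟩ := hxe i
  exact ⟨(hφ _).1 hei, Finset.mem_map_of_mem _ hxi, Finset.mem_map_of_mem _ hxi'⟩

theorem IsIsomorphic.isSupertree (h : G.IsIsomorphic H) (hG : G.IsSupertree) : H.IsSupertree :=
  ⟨h.connected hG.1, fun hH => hG.2 (h.symm.hasCycle hH)⟩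

theorem exists_isIsomorphic (G : FinHypergraph V) (φ : V ≃ W) :
    ∃ H : FinHypergraph W, G.IsIsomorphic H := by
  refine ⟨⟨G.edges.map φ.finsetCongr.toEmbedding, fun e he => ?_⟩, φ, fun e => ?_⟩
  · obtain ⟨c, hc, rfl⟩ := Finset.mem_map.1 he
    exact (G.nonempty_of_mem c hc).map
  · exact (Finset.mem_map' φ.finsetCongr.toEmbedding).symm

theorem sum_edges_of_equiv {M : Type*} [AddCommMonoid M]
    (hφ : ∀ e : Finset V, e ∈ G.edges ↔ e.map φ.toEmbedding ∈ H.edges) (F : Finset W → M) :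
    ∑ e ∈ H.edges, F e = ∑ e ∈ G.edges, F (e.map φ.toEmbedding) :=
  (Finset.sum_equiv φ.finsetCongr (fun e => hφ e) fun _ _ => rfl).symm

variable [DecidableEq V] [DecidableEq W]

theorem degree_of_equiv (hφ : ∀ e : Finset V, e ∈ G.edges ↔ e.map φ.toEmbedding ∈ H.edges)
    (v : V) : H.degree (φ v) = G.degree v := by
  simp only [degree, Finset.card_filter, sum_edges_of_equiv hφ, Finset.mem_map_equiv,
    Equiv.symm_apply_apply]

theorem isBoundary_iff_of_equiv
    (hφ : ∀ e : Finset V, e ∈ G.edges ↔ e.map φ.toEmbedding ∈ H.edges) (v : V) :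
    H.IsBoundary (φ v) ↔ G.IsBoundary v := by
  rw [IsBoundary, IsBoundary, degree_of_equiv hφ]

theorem lapMatrix_of_equiv (hφ : ∀ e : Finset V, e ∈ G.edges ↔ e.map φ.toEmbedding ∈ H.edges)
    (i j : V) : H.lapMatrix (φ i) (φ j) = G.lapMatrix i j := by
  simp only [lapMatrix, Matrix.sub_apply, Matrix.diagonal_apply, φ.apply_eq_iff_eq,
    degree_of_equiv hφ, adjMatrix, Matrix.of_apply, Finset.sum_filter, sum_edges_of_equiv hφ,
    Finset.mem_map_equiv, Equiv.symm_apply_apply, Finset.card_map]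

variable [Fintype V] [Fintype W]

theorem IsIsomorphic.degreeSequence_eq (h : G.IsIsomorphic H) :
    H.degreeSequence = G.degreeSequence := by
  obtain ⟨φ, hφ⟩ := h
  rw [degreeSequence, degreeSequence, ← Multiset.map_univ_val_equiv φ, Multiset.map_map]
  exact Multiset.map_congr rfl fun v _ => degree_of_equiv hφ v

theorem IsIsomorphic.memClass (h : G.IsIsomorphic H) (hG : G.MemClass k π) : H.MemClass k π :=
  ⟨h.isUniform hG.isUniform, h.isSupertree hG.isSupertree,
    h.degreeSequence_eq.trans hG.degreeSequence_eq⟩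

theorem IsIsomorphic.isDirichletEigenvalue (h : G.IsIsomorphic H)
    (hμ : G.IsDirichletEigenvalue μ) : H.IsDirichletEigenvalue μ := by
  obtain ⟨φ, hφ⟩ := h
  obtain ⟨f, hf, heq, h0⟩ := hμ
  refine ⟨f ∘ φ.symm, fun hzero => hf ?_, φ.surjective.forall.2 fun v hv => ?_,
    φ.surjective.forall.2 fun v hv => ?_⟩
  · funext v
    simpa using congrFun hzero (φ v)
  · rw [isBoundary_iff_of_equiv hφ] at hv
    rw [Function.comp_apply, φ.symm_apply_apply, ← heq v hv, Matrix.mulVec, Matrix.mulVec,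
      dotProduct, dotProduct]
    refine (Fintype.sum_equiv φ _ _ fun j => ?_).symm
    rw [lapMatrix_of_equiv hφ, Function.comp_apply, φ.symm_apply_apply]
  · rw [isBoundary_iff_of_equiv hφ] at hv
    simpa using h0 v hv

theorem IsIsomorphic.firstDirichletEigenvalue_eq (h : G.IsIsomorphic H) :
    G.firstDirichletEigenvalue = H.firstDirichletEigenvalue :=
  congrArg sInf (Set.ext fun _ => ⟨h.isDirichletEigenvalue, h.symm.isDirichletEigenvalue⟩)

theorem IsIsomorphic.hasFaberKrahn (h : G.IsIsomorphic H) (hG : G.HasFaberKrahn k π) :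
    H.HasFaberKrahn k π := by
  refine ⟨h.memClass hG.1, ?_⟩
  rw [← h.firstDirichletEigenvalue_eq]
  exact hG.2

theorem MemClass.exists_hasFaberKrahn (hG : G.MemClass k π) :
    ∃ G' : FinHypergraph V, G'.HasFaberKrahn k π := by
  have : Finite (FinHypergraph V) :=
    Finite.of_injective FinHypergraph.edges fun _ _ => FinHypergraph.ext
  obtain ⟨G', hG', hmin⟩ := Set.exists_min_image {G' : FinHypergraph V | G'.MemClass k π}
    firstDirichletEigenvalue (Set.toFinite _) ⟨G, hG⟩
  refine ⟨G', hG', fun U _ _ H hH => ?_⟩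
  obtain ⟨H', hH'⟩ := H.exists_isIsomorphic
    (Fintype.equivOfCardEq (hH.card_eq.trans hG.card_eq.symm))
  rw [hH'.firstDirichletEigenvalue_eq]
  exact hmin H' (hH'.memClass hH)

end Transport

end FinHypergraph

/-- Let `k ≥ 2`. A `k`-uniform supertree with degree sequence `π` has the Faber–Krahn property in
`T_π` if and only if it has an SLO-ordering. If `T_π` is non-empty, such an extremal supertree
exists, and any two of them are isomorphic. -/
theorem mainTheorem1 (k : ℕ) (hk : 2 ≤ k) (π : Multiset ℕ) :
    (∀ (V : Type u) [Fintype V] [DecidableEq V] (G : FinHypergraph V),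
      G.MemClass k π → (G.HasFaberKrahn k π ↔ G.HasSLO)) ∧
    (∀ (V : Type u) [Fintype V] [DecidableEq V] (G : FinHypergraph V),
      G.MemClass k π → ∃ G' : FinHypergraph V, G'.HasFaberKrahn k π) ∧
    (∀ (V W : Type u) [Fintype V] [DecidableEq V] [Fintype W] [DecidableEq W]
      (G : FinHypergraph V) (H : FinHypergraph W),
      G.HasFaberKrahn k π → H.HasFaberKrahn k π → G.IsIsomorphic H) := by
  refine ⟨fun V _ _ G hG => ⟨fun hFK => hFK.hasSLO hk, fun hSLO => ?_⟩,
    fun V _ _ G hG => hG.exists_hasFaberKrahn, fun V W _ _ _ _ G H hG hH =>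
      (hG.hasSLO hk).isIsomorphic hk hG.1 hH.1 (hH.hasSLO hk)⟩
  obtain ⟨G', hG'⟩ := hG.exists_hasFaberKrahn
  exact ((hG'.hasSLO hk).isIsomorphic hk hG'.1 hG hSLO).hasFaberKrahn hG'
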